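/- **Model.** Time is measured in slots $t=0,1,2,\dots$; round $j\ge 0$ starts at time $j\tau_{\rm r}$ and lasts $\tau_{\rm r}$ slots. A single sensor at $\mathbf x$ in a measurable planar region $\Phi$ with area $0<|\Phi|<\infty$ senses at the start of each round with probability $p_{\rm s}>0$ and chooses edge computing (mode $\mathrm e$) with probability $p_{\rm e}$, otherwise local computing (mode $\ell$). Sensing takes one slot, computing takes $\tau_m$ slots in mode $m\in\{\mathrm e,\ell\}$, and the data is transmitted, one slot per attempt, until the first success, at most $\delta\ge 1$ times; then it is dropped. An attempt in mode $m$ fails if $W\log_2(1+\gamma)<R_m$, where $\gamma$ is its SINR; this has probability $p_{{\rm o},m}<1$. All sensing decisions, computing decisions and SINRs are independent, and $1+\delta+\tau_m\le\tau_{\rm r}$ for both modes. Hence a round in which the sensor senses in mode $m$ and the $c$-th attempt is the first success ($1\le c\le\delta$) causes an update of the sink $1+c+\tau_m$ slots after the start of the round. The age of information $\Delta(t)$ is $t$ minus the generation time (start of the round of sensing) of the most recent data at the sink, the sink initially holding data generated at time $0$. **Coverage.** With $\beta_1,\beta_2>0$ and $\epsilon_0<1$, data of age $a$ covers the points $\mathbf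 y$ with $1-\exp(-2\beta_1\|\mathbf x-\mathbf y\|-2\beta_2a)\le\epsilon_0$. Let $\phi_{\rm cov}(t)$ be the area of the part of $\Phi$ covered with age $a=\Delta(t)$, divided by $|\Phi|$. For $\eta>0$ let $\mathcal P_{\rm c}(\eta)=\mathbb P[\phi_{\rm cov}(t)\ge\eta]$ in steady state, i.e. the limit, as $T\to\infty$, both of $\frac1T\sum_{t<T}\mathbb P[\phi_{\rm cov}(t)\ge\eta]$ and, almost surely, of the fraction of slots $t<T$ with $\phi_{\rm cov}(t)\ge\eta$; $\mathbb P[\Delta>v]$ is understood in the same way. Assume that $\Phi$ contains the covered set for every age $a\ge 2+\min(\tau_{\rm e},\tau_\ell)$, or that $\Phi$ contains the closed disc about $\mathbf x$ of radius $\sqrt{\eta|\Phi|/\pi}$. **Notation.** $\zeta_m(c)=1-p_{{\rm o},m}^{\,c}$, $\;p_x=p_{\rm s}\{p_{\rm e}\zeta_{\rm e}(\delta)+(1-p_{\rm e})\zeta_\ell(\delta)\}$, $$p'_{\rm e}=\frac{p_{\rm e}\zeta_{\rm e}(\delta)}{p_{\rm e}\zeta_{\rm e}(\delta)+(1-p_{\rm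 e})\zeta_\ell(\delta)},\quad p'_\ell=1-p'_{\rm e},\qquad v_{\rm th}=-\frac{\beta_1}{\beta_2}\sqrt{\frac{\eta|\Phi|}{\pi}}-\frac{\log(1-\epsilon_0)}{2\beta_2},$$ $F_m=\frac1{\zeta_m(1)}-\frac{\delta p_{{\rm o},m}^{\delta}}{\zeta_m(\delta)}$, $\;H_m(y)=1+\delta+\tau_m+\tau_{\rm r}(y-1)$, $\;n=\lfloor v_{\rm th}\rfloor$, $\;f_m(y)=n-\tau_m-\tau_{\rm r}y-1$. For modes $m',m$ put $a=n-1-\tau_{m'}$; then $G(m',m)$ equals 1. $\frac{\tau_{\rm r}}{p_x}+\tau_m-\tau_{m'}+F_m-F_{m'}$ if $v_{\rm th}<2+\tau_{m'}$; 2. $\frac{\tau_{\rm r}}{p_x}+\tau_m-\tau_{m'}+F_m-\frac{n-\tau_{m'}-p_{{\rm o},m'}^{a}-\delta p_{{\rm o},m'}^{\delta}}{\zeta_{m'}(\delta)}-\frac{p_{{\rm o},m'}^{a}-p_{{\rm o},m'}^{\delta}}{\zeta_{m'}(\delta)\zeta_{m'}(1)}$ if $2+\tau_{m'}\le v_{\rm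 th}<1+\delta+\tau_{m'}$; 3. $\frac{\tau_{\rm r}}{p_x}+\tau_m+F_m-n$ if $1+\delta+\tau_{m'}\le v_{\rm th}<\tau_{\rm r}+2+\tau_m$; 4. with $f=f_m(y)$, $\;(1-p_x)^{y-1}\Big[(1-p_x)\big\{H_m(y)+\frac{\tau_{\rm r}}{p_x}-\frac{\delta}{\zeta_m(\delta)}+\frac1{\zeta_m(1)}\big\}+(1-\tau_{\rm r}+n)\big\{\frac{p_x\zeta_m(f)}{\zeta_m(\delta)}-1\big\}+\frac{p_x}{\zeta_m(\delta)}\big\{p_{{\rm o},m}^{f}(n-\tau_{\rm r})-p_{{\rm o},m}^{\delta}H_m(y)+\frac{p_{{\rm o},m}^{f}-p_{{\rm o},m}^{\delta}}{\zeta_m(1)}\big\}\Big]$ if $y\tau_{\rm r}+2+\tau_m\le v_{\rm th}<y\tau_{\rm r}+1+\delta+\tau_m$, $y=1,2,\dots$; 5. $(1-p_x)^y\big\{-f_m(y)-1+\frac{\tau_{\rm r}}{p_x}+\frac1{\zeta_m(1)}+\delta\big(1-\frac1{\zeta_m(\delta)}\big)\big\}$ if $y\tau_{\rm r}+1+\delta+\tau_m\le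 v_{\rm th}<(y+1)\tau_{\rm r}+2+\tau_m$, $y=1,2,\dots$. For consecutive updates $k-1,k$ let $Z_k$ be the time from sensing to the $k$-th update, $X_k$ the time from the start of the first round after the $(k-1)$-th update's round to the $k$-th update, $U_k=\tau_{\rm r}-Z_{k-1}+X_k$ the inter-update time, and let the violation time $g_k$ be $\tau_{\rm r}+X_k-Z_{k-1}$ if $v_{\rm th}<Z_{k-1}$, $\tau_{\rm r}+X_k-(\lfloor v_{\rm th}\rfloor+1)$ if $Z_{k-1}\le v_{\rm th}<\tau_{\rm r}+X_k$, and $0$ otherwise. **Claim.** The steady-state probabilities exist, $U_k$ and $g_k$ are integrable, and $$\mathcal P_{\rm c}(\eta)=1-\mathbb P[\Delta>v_{\rm th}]=1-\frac{p_x}{\tau_{\rm r}}\sum_{m'\in\{{\rm e},\ell\}}\sum_{m\in\{{\rm e},\ell\}}p'_{m'}p'_{m}\,G(m',m),$$ where $\mathbb P[\Delta>v_{\rm th}]=\mathbb E[g_k]/\mathbb E[U_k]$, $\;\mathbb E[U_k]=\tau_{\rm r}/p_x$ and $\mathbb E[g_k]=\sum_{m'}\sum_m p'_{m'}p'_mG(m',m)$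 for every pair of consecutive updates. -/

import Mathlib

open MeasureTheory ProbabilityTheory Filter Topology

/-- Computing decision: at the edge server (`ec`) or locally at the sensor (`lc`). -/
inductive Mode where
  | ec
  | lc

instance : MeasurableSpace Mode := ⊤

/-- The plane with the Euclidean metric and Lebesgue measure. -/
abbrev Plane := EuclideanSpace ℝ (Fin 2)

/-- Index set of the primitive random variables: the sensing decision of round `j`, the computing
decision of round `j`, and the SINR of the `c`-th transmission attempt of round `j`. -/
inductive Source where
  | sense (j : ℕ)
  | comp (j : ℕ)
  | sinr (j c : ℕ)

/-- Value space of each primitive random variable. -/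
abbrev Source.Val : Source → Type
  | .sense _ => Bool
  | .comp _ => Mode
  | .sinr _ _ => ℝ

instance : (i : Source) → MeasurableSpace i.Val
  | .sense _ => inferInstanceAs (MeasurableSpace Bool)
  | .comp _ => inferInstanceAs (MeasurableSpace Mode)
  | .sinr _ _ => inferInstanceAs (MeasurableSpace ℝ)

/-- Numerical data of the single-sensor network; time is measured in slots. -/
structure Network where
  /-- slots per round -/
  τr : ℕ
  /-- maximal number of transmission attempts for one data item -/
  δ : ℕ
  /-- computing time for each computing mode -/
  τ : Mode → ℕ
  /-- sensing probability -/
  ps : ℝ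
  /-- probability of choosing edge computing -/
  pe : ℝ
  /-- bandwidth -/
  W : ℝ
  /-- target data rate for each computing mode -/
  R : Mode → ℝ
  /-- outage probability of one transmission attempt for each computing mode -/
  po : Mode → ℝ
  /-- weight of the spatial error -/
  β₁ : ℝ
  /-- weight of the temporal error -/
  β₂ : ℝ
  /-- error threshold -/
  ε₀ : ℝ
  /-- target coverage ratio -/
  η : ℝ
  /-- location of the sensor -/
  x : Plane
  /-- network region -/
  Φ : Set Plane

noncomputable section

namespace Network

variable (N : Network)

/-! ### The random model -/

section Dynamics

variable {Ω : Type*} (ξ : (i : Source) → Ω → i.Val)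

/-- The `c`-th transmission attempt of round `j` would fail for data computed in mode `m`. -/
def Outage (m : Mode) (j c : ℕ) (ω : Ω) : Prop :=
  N.W * Real.logb 2 (1 + (ξ (.sinr j c) ω : ℝ)) < N.R m

/-- The primitive variables are independent and have the prescribed marginals. -/
structure IsModel [MeasurableSpace Ω] (μ : Measure Ω) : Prop where
  measurable : ∀ i, Measurable (ξ i)
  indep : iIndepFun ξ μ
  sense_prob : ∀ j, μ.real {ω | (ξ (.sense j) ω : Bool) = true} = N.ps
  comp_prob : ∀ j, μ.real {ω | (ξ (.comp j) ω : Mode) = Mode.ec} = N.pe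
  outage_prob : ∀ m j c, μ.real {ω | N.Outage ξ m j c ω} = N.po m

/-- Computing decision of round `j`. -/
def mode (j : ℕ) (ω : Ω) : Mode := ξ (.comp j) ω

/-- Round `j` leads to a successful update: the sensor senses, and one of the at most `δ`
transmission attempts, numbered `1, …, δ`, does not fail. -/
def Success (j : ℕ) (ω : Ω) : Prop :=
  (ξ (.sense j) ω : Bool) = true ∧
    ∃ c, 1 ≤ c ∧ c ≤ N.δ ∧ ¬ N.Outage ξ (mode ξ j ω) j c ω

/-- Number of the first successful transmission attempt of round `j`. -/
def attempts (j : ℕ) (ω : Ω) : ℕ :=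
  sInf {c | 1 ≤ c ∧ ¬ N.Outage ξ (mode ξ j ω) j c ω}

/-- Time from the sensing instant (the start of round `j`) to the update at the sink caused by a
successful round `j`: one slot of sensing, the transmissions, and the computation. -/
def delay (j : ℕ) (ω : Ω) : ℕ := 1 + N.attempts ξ j ω + N.τ (mode ξ j ω)

open Classical in
/-- Generation time of the most recent data available at the sink at time `t`. Initially the sink
holds data generated at time `0`. -/
def lastGen (t : ℕ) (ω : Ω) : ℕ :=
  ((Finset.range (t + 1)).filter
    (fun j => N.Success ξ j ω ∧ j * N.τr + N.delay ξ j ω ≤ t)).sup (fun j => j * N.τr)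

/-- Age of information at the sink at time `t`. -/
def aoi (t : ℕ) (ω : Ω) : ℝ := (t : ℝ) - (N.lastGen ξ t ω : ℝ)

open Classical in
/-- The round that causes the `k`-th successful update, `k = 0, 1, …`. -/
def updateRound (k : ℕ) (ω : Ω) : ℕ := Nat.nth (fun j => N.Success ξ j ω) k

/-- `Z_k`: time from sensing to the `k`-th successful update. -/
def Z (k : ℕ) (ω : Ω) : ℝ := (N.delay ξ (N.updateRound ξ k ω) ω : ℝ)

/-- Time of the `k`-th successful update. -/
def updateTime (k : ℕ) (ω : Ω) : ℝ := (N.updateRound ξ k ω : ℝ) * N.τr + N.Z ξ k ω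

/-- `X_k`: time from the start of the first round after the `(k-1)`-th successful update to the
`k`-th successful update (`k ≥ 1`). -/
def X (k : ℕ) (ω : Ω) : ℝ :=
  N.updateTime ξ k ω - ((N.updateRound ξ (k - 1) ω : ℝ) + 1) * N.τr

/-- `U_k`: time between the `(k-1)`-th and the `k`-th successful update (`k ≥ 1`). -/
def U (k : ℕ) (ω : Ω) : ℝ := N.updateTime ξ k ω - N.updateTime ξ (k - 1) ω

/-- `g_k`: violation time of the target age `v` between the `(k-1)`-th and the `k`-th successful
update (`k ≥ 1`). -/
def g (v : ℝ) (k : ℕ) (ω : Ω) : ℝ :=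
  if v < N.Z ξ (k - 1) ω then N.τr + N.X ξ k ω - N.Z ξ (k - 1) ω
  else if v < N.τr + N.X ξ k ω then N.τr + N.X ξ k ω - ((⌊v⌋ : ℝ) + 1)
  else 0

end Dynamics

/-! ### Coverage -/

/-- Error of estimating the data at distance `d` from the sensor by data of age `a`. -/
def estError (d a : ℝ) : ℝ := 1 - Real.exp (-N.β₁ * d - N.β₂ * a) ^ 2

/-- Sensing coverage with data of age `a`: the points at which the error is at most `ε₀`. -/
def coverage (a : ℝ) : Set Plane := {y | N.estError (dist N.x y) a ≤ N.ε₀}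

/-- Area of the network region. -/
def area : ℝ := volume.real N.Φ

/-- Network coverage ratio with data of age `a`. -/
def coverageRatio (a : ℝ) : ℝ := volume.real (N.coverage a ∩ N.Φ) / N.area

/-- Radius of a disc of area `η |Φ|`. -/
def targetRadius : ℝ := √(N.η * N.area / Real.pi)

/-- Target age of information. -/
def vth : ℝ := -(N.β₁ / N.β₂) * N.targetRadius - Real.log (1 - N.ε₀) / (2 * N.β₂)

/-! ### The closed form -/

/-- Probability `1 - p_o ^ c` that one of `c` transmission attempts succeeds. -/
def ζ (m : Mode) (c : ℤ) : ℝ := 1 - N.po m ^ c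

/-- Probability that a round leads to a successful update. -/
def px : ℝ := N.ps * (N.pe * N.ζ .ec N.δ + (1 - N.pe) * N.ζ .lc N.δ)

/-- Probability of each computing mode, conditioned on a successful update. -/
def pcond : Mode → ℝ
  | .ec => N.pe * N.ζ .ec N.δ / (N.pe * N.ζ .ec N.δ + (1 - N.pe) * N.ζ .lc N.δ)
  | .lc => (1 - N.pe) * N.ζ .lc N.δ / (N.pe * N.ζ .ec N.δ + (1 - N.pe) * N.ζ .lc N.δ)

def F₁ (m : Mode) : ℝ := 1 / N.ζ m 1 - N.δ * N.po m ^ N.δ / N.ζ m N.δ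

def F₂ (m : Mode) (y : ℕ) : ℝ := 1 + N.δ + N.τ m + N.τr * ((y : ℝ) - 1)

def F₃ (v : ℝ) (m : Mode) (y : ℕ) : ℤ := ⌊v⌋ - N.τ m - N.τr * y - 1

def v₁ (m' : Mode) : ℝ := 2 + N.τ m'

def v₂ (m' : Mode) : ℝ := 1 + N.δ + N.τ m'

def v₃ (m : Mode) (y : ℕ) : ℝ := y * N.τr + 2 + N.τ m

def v₄ (m : Mode) (y : ℕ) : ℝ := y * N.τr + 1 + N.δ + N.τ m

/-- For `v ≥ v₃ m 1`, the only `y ≥ 1` with `v₃ m y ≤ v < v₃ m (y + 1)`. -/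
def yIdx (v : ℝ) (m : Mode) : ℕ := ⌊(v - 2 - N.τ m) / N.τr⌋₊

/-- The function `G(m', m)` for the target age `v`, where `m'` is the mode of the previous and `m`
the mode of the current update. -/
def G (v : ℝ) (m' m : Mode) : ℝ :=
  let y := N.yIdx v m
  let f := N.F₃ v m y
  let a : ℤ := ⌊v⌋ - 1 - N.τ m'
  if v < N.v₁ m' then
    N.τr / N.px + N.τ m - N.τ m' + N.F₁ m - N.F₁ m'
  else if v < N.v₂ m' then
    N.τr / N.px + N.τ m - N.τ m' + N.F₁ m
      - (⌊v⌋ - N.τ m' - N.po m' ^ a - N.δ * N.po m' ^ N.δ) / N.ζ m' N.δ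
      - (N.po m' ^ a - N.po m' ^ N.δ) / (N.ζ m' N.δ * N.ζ m' 1)
  else if v < N.v₃ m 1 then
    N.τr / N.px + N.τ m + N.F₁ m - ⌊v⌋
  else if v < N.v₄ m y then
    (1 - N.px) ^ (y - 1) *
      ((1 - N.px) * (N.F₂ m y + N.τr / N.px - N.δ / N.ζ m N.δ + 1 / N.ζ m 1)
        + (1 - N.τr + ⌊v⌋) * (N.px * N.ζ m f / N.ζ m N.δ - 1)
        + N.px / N.ζ m N.δ *
          (N.po m ^ f * (⌊v⌋ - N.τr) - N.po m ^ N.δ * N.F₂ m y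
            + (N.po m ^ f - N.po m ^ N.δ) / N.ζ m 1))
  else
    (1 - N.px) ^ y *
      (-f - 1 + N.τr / N.px + 1 / N.ζ m 1 + N.δ * (1 - 1 / N.ζ m N.δ))

/-- The closed form `Σ_{m'} Σ_m p'_{m'} p'_m G(m', m)` of the expected violation time. -/
def meanViolation (v : ℝ) : ℝ :=
  N.pcond .ec * N.pcond .ec * N.G v .ec .ec + N.pcond .ec * N.pcond .lc * N.G v .ec .lc
    + N.pcond .lc * N.pcond .ec * N.G v .lc .ec + N.pcond .lc * N.pcond .lc * N.G v .lc .lc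

end Network

open Classical in
/-- `p` is the steady-state probability of the time-dependent event `E t`, `t = 0, 1, …`: the
probability that `E` holds at a slot drawn uniformly from the first `T` slots tends to `p` as
`T → ∞`, and almost surely the fraction of the first `T` slots in which `E` holds tends to `p`. -/
def IsSteadyStateProb {Ω : Type*} [MeasurableSpace Ω] (μ : Measure Ω) (E : ℕ → Set Ω) (p : ℝ) :
    Prop :=
  Tendsto (fun T : ℕ => (∑ t ∈ Finset.range T, μ.real (E t)) / (T : ℝ)) atTop (𝓝 p) ∧
  ∀ᵐ ω ∂μ, Tendsto
    (fun T : ℕ => (((Finset.range T).filter (fun t => ω ∈ E t)).card : ℝ) / (T : ℝ)) atTop (𝓝 p)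

end

/-! ### Cesàro means -/

/-! Only the lag of each round matters: the time from its start to the update it causes, or 0 if it
causes none. Lags of distinct rounds are independent, identically distributed and at most T = τr;
put D d = P(1 ≤ lag ≤ d) (`deliveryProb`). Let κ be the least natural number exceeding v_th.

At a time t ≥ κ the age is at least κ exactly when no round started less than κ slots ago has
delivered yet. By independence this has probability ∏ (1 - D d) over the ages d < κ congruent to t
modulo T (`survival`). It is periodic in t, so its time averages converge. Events at least κ slots
apart are independent, so the strong law along residue classes gives the same limit almost surely.
Raising κ by one changes a single residue class; hence the average over a period telescopes to (T -
Σ_{a<κ} D a · S a) / T, where S a = `survival D T a a` (`sum_survival`).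

The same terms describe one update cycle. That the data of the k-th delivering round is the most
recent when it has age a splits into independent conditions on the earlier rounds, that round and
the later rounds, and has probability D a · S a / D T (`measure_currentSet`). Summing over a ≥ κ
counts the slots of the cycle with age at least κ. Since Σ_a D a · S a = T, their mean number is (T
- Σ_{a<κ} D a · S a) / D T, where D T = px. This is E[g]; κ = 0 gives E[U] = T / px. The ratio is
the limit found above, so no renewal reward theorem is needed.

For the closed form, D is px times the mixture over modes of the conditional delay distributions,
and S is the mixture of the tails of the peak age. The sum thus splits over pairs of modes, and
G(m', m) is the mean peak age minus the mean delay minus Σ_{a<κ} P(delay ≤ a) P(peak > a) (`G_eq`).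
Finally, the covered set is a disc that shrinks with age and reaches the target area exactly for
ages at most v_th (`le_coverageRatio_iff`). -/

theorem tendsto_cesaro_of_shift {u : ℕ → ℝ} {c : ℝ} (t₀ : ℕ)
    (h : Tendsto (fun T : ℕ => (∑ t ∈ Finset.range T, u (t + t₀)) / (T : ℝ)) atTop (𝓝 c)) :
    Tendsto (fun T : ℕ => (∑ t ∈ Finset.range T, u t) / (T : ℝ)) atTop (𝓝 c) := by
  rw [← tendsto_add_atTop_iff_nat t₀]
  have h1 : Tendsto (fun T : ℕ => (∑ t ∈ Finset.range t₀, u t) / ((T + t₀ : ℕ) : ℝ)) atTop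
      (𝓝 0) :=
    (tendsto_add_atTop_iff_nat (f := fun T : ℕ => (∑ t ∈ Finset.range t₀, u t) / (T : ℝ)) t₀).2
      (tendsto_const_div_atTop_nhds_zero_nat _)
  have h2 : Tendsto (fun T : ℕ => 1 - (t₀ : ℝ) / ((T + t₀ : ℕ) : ℝ)) atTop (𝓝 (1 - 0)) :=
    tendsto_const_nhds.sub
      ((tendsto_add_atTop_iff_nat (f := fun T : ℕ => (t₀ : ℝ) / (T : ℝ)) t₀).2
        (tendsto_const_div_atTop_nhds_zero_nat _))
  have h3 := h1.add (h.mul h2)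
  rw [sub_zero, mul_one, zero_add] at h3
  refine h3.congr' ?_
  filter_upwards [eventually_gt_atTop 0] with T hT
  have hT' : (0 : ℝ) < T := by exact_mod_cast hT
  have hT'' : (0 : ℝ) < T + t₀ := by positivity
  rw [add_comm T t₀, Finset.sum_range_add]
  simp_rw [add_comm t₀]
  push_cast
  field_simp
  ring

theorem tendsto_cesaro_congr {u w : ℕ → ℝ} {c : ℝ} (t₀ : ℕ) (huw : ∀ t, t₀ ≤ t → u t = w t)
    (h : Tendsto (fun T : ℕ => (∑ t ∈ Finset.range T, u t) / (T : ℝ)) atTop (𝓝 c)) :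
    Tendsto (fun T : ℕ => (∑ t ∈ Finset.range T, w t) / (T : ℝ)) atTop (𝓝 c) := by
  have h1 := h.add (tendsto_const_div_atTop_nhds_zero_nat (∑ t ∈ Finset.range t₀, (w t - u t)))
  rw [add_zero] at h1
  refine h1.congr' ?_
  filter_upwards [eventually_ge_atTop t₀] with T hT
  obtain ⟨s, rfl⟩ := Nat.exists_eq_add_of_le hT
  rw [← add_div, Finset.sum_range_add, Finset.sum_range_add, Finset.sum_sub_distrib]
  congr 1
  rw [Finset.sum_congr rfl fun i _ => huw (t₀ + i) (Nat.le_add_right _ _)]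
  ring

theorem sum_range_mul_eq_sum_residues (u : ℕ → ℝ) (Q M : ℕ) :
    ∑ t ∈ Finset.range (M * Q), u t =
      ∑ r ∈ Finset.range Q, ∑ i ∈ Finset.range M, u (r + i * Q) := by
  induction M with
  | zero => simp
  | succ M ih =>
    rw [Nat.succ_mul, Finset.sum_range_add, ih, ← Finset.sum_add_distrib]
    refine Finset.sum_congr rfl fun r _ => ?_
    rw [Finset.sum_range_succ, add_comm r]

/-- Up to T / Q * Q the sum regroups by residues. Fewer than Q bounded terms remain, and they vanish
after division by T. -/
theorem tendsto_cesaro_of_residues {u c : ℕ → ℝ} {Q : ℕ} (hQ : 0 < Q)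
    (hu : ∀ t, |u t| ≤ 1)
    (h : ∀ r < Q, Tendsto (fun M : ℕ => (∑ i ∈ Finset.range M, u (r + i * Q)) / (M : ℝ)) atTop
      (𝓝 (c r))) :
    Tendsto (fun T : ℕ => (∑ t ∈ Finset.range T, u t) / (T : ℝ)) atTop
      (𝓝 ((∑ r ∈ Finset.range Q, c r) / Q)) := by
  have hdiv : Tendsto (fun T : ℕ => T / Q) atTop atTop :=
    Nat.tendsto_div_const_atTop hQ.ne'
  have h1 : Tendsto (fun T : ℕ => ∑ r ∈ Finset.range Q,
      (∑ i ∈ Finset.range (T / Q), u (r + i * Q)) / ((T / Q : ℕ) : ℝ)) atTop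
      (𝓝 (∑ r ∈ Finset.range Q, c r)) :=
    tendsto_finsetSum _ fun r hr => (h r (Finset.mem_range.1 hr)).comp hdiv
  have h2 : Tendsto (fun T : ℕ => ((T / Q : ℕ) : ℝ) / (T : ℝ)) atTop (𝓝 (1 / Q)) := by
    have := (tendsto_nat_floor_mul_div_atTop (R := ℝ) (a := 1 / (Q : ℝ)) (by positivity)).comp
      tendsto_natCast_atTop_atTop
    refine this.congr fun T => ?_
    simp only [Function.comp]
    rw [one_div_mul_eq_div, Nat.floor_div_natCast, Nat.floor_natCast]
  have h3 : Tendsto (fun T : ℕ => (∑ i ∈ Finset.range (T % Q), u (T / Q * Q + i)) / (T : ℝ)) atTop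
      (𝓝 0) := by
    refine squeeze_zero_norm (fun T => ?_) (tendsto_const_div_atTop_nhds_zero_nat (Q : ℝ))
    rw [norm_div, Real.norm_natCast, Real.norm_eq_abs]
    gcongr
    calc |∑ i ∈ Finset.range (T % Q), u (T / Q * Q + i)|
        ≤ ∑ i ∈ Finset.range (T % Q), |u (T / Q * Q + i)| := Finset.abs_sum_le_sum_abs _ _
      _ ≤ ∑ i ∈ Finset.range (T % Q), 1 := Finset.sum_le_sum fun i _ => hu _
      _ = ((T % Q : ℕ) : ℝ) := by simp
      _ ≤ Q := by exact_mod_cast (Nat.mod_lt T hQ).le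
  have h4 := (h1.mul h2).add h3
  rw [add_zero, mul_one_div] at h4
  refine h4.congr' ?_
  filter_upwards [eventually_ge_atTop Q] with T hT
  have hT' : (0 : ℝ) < T := by exact_mod_cast hQ.trans_le hT
  have hM : (0 : ℝ) < ((T / Q : ℕ) : ℝ) := by exact_mod_cast Nat.div_pos hT hQ
  have hsplit : ∑ t ∈ Finset.range T, u t = ∑ t ∈ Finset.range (T / Q * Q), u t +
      ∑ i ∈ Finset.range (T % Q), u (T / Q * Q + i) := by
    rw [← Finset.sum_range_add, Nat.div_add_mod']
  rw [hsplit, sum_range_mul_eq_sum_residues, ← Finset.sum_div]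
  field_simp

/-! ### Independence -/

section Independence

variable {Ω : Type*} [mΩ : MeasurableSpace Ω] {μ : Measure Ω}

/-- Merging the members of an independent family of σ-algebras along a map gives an independent
family. -/
theorem iIndep_iSup_fiber {ι κ : Type*} [IsProbabilityMeasure μ] {m : ι → MeasurableSpace Ω}
    (hle : ∀ i, m i ≤ mΩ) (h : iIndep m μ) (r : ι → κ) :
    iIndep (fun k => ⨆ i ∈ {i | r i = k}, m i) μ := by
  classical
  rw [iIndep_iff]
  intro s
  induction s using Finset.induction_on with
  | empty => intro f _; simp
  | insert a s ha ih =>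
    intro f hf
    rw [Finset.prod_insert ha, Finset.set_biInter_insert,
      ← ih fun i hi => hf i (Finset.mem_insert_of_mem hi)]
    have hdisj : Disjoint {i | r i = a} {i | r i ∈ s} := by
      rw [Set.disjoint_left]
      rintro i (rfl : r i = a) (hi : r i ∈ s)
      exact ha hi
    refine (Indep_iff _ _ μ).1 (indep_iSup_of_disjoint hle h hdisj) _ _
      (hf a (Finset.mem_insert_self _ _)) ?_
    refine Finset.measurableSet_biInter _ fun k hk => ?_
    have hmono : (⨆ i ∈ {i | r i = k}, m i) ≤ ⨆ i ∈ {i | r i ∈ s}, m i :=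
      biSup_mono fun i (hi : r i = k) => show r i ∈ s by rw [hi]; exact hk
    exact hmono _ (hf k (Finset.mem_insert_of_mem hk))

theorem identDistrib_indicator_one {E F : Set Ω} (hE : MeasurableSet E) (hF : MeasurableSet F)
    [IsProbabilityMeasure μ] (h : μ E = μ F) :
    IdentDistrib (E.indicator (1 : Ω → ℝ)) (F.indicator (1 : Ω → ℝ)) μ μ := by
  refine ⟨(measurable_one.indicator hE).aemeasurable, (measurable_one.indicator hF).aemeasurable,
    ?_⟩
  ext s hs
  rw [Measure.map_apply (measurable_one.indicator hE) hs,
    Measure.map_apply (measurable_one.indicator hF) hs]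
  have hc : μ Eᶜ = μ Fᶜ := by
    rw [prob_compl_eq_one_sub hE, prob_compl_eq_one_sub hF, h]
  classical
  simp_rw [Pi.one_def, Set.indicator_const_preimage_eq_union]
  split_ifs <;> simp [h, hc]

theorem comap_indicator_one_le {Ω' : Type*} {m : MeasurableSpace Ω'} {E : Set Ω'}
    (hE : MeasurableSet E) :
    (inferInstance : MeasurableSpace ℝ).comap (E.indicator (1 : Ω' → ℝ)) ≤ m :=
  (measurable_one.indicator hE).comap_le

theorem indepFun_indicator_one {E F : Set Ω} (h : IndepSet E F μ) :
    IndepFun (E.indicator (1 : Ω → ℝ)) (F.indicator (1 : Ω → ℝ)) μ :=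
  indep_of_indep_of_le_left (indep_of_indep_of_le_right ((IndepSet_iff_Indep _ _ _).1 h)
    (comap_indicator_one_le (MeasurableSpace.measurableSet_generateFrom rfl)))
    (comap_indicator_one_le (MeasurableSpace.measurableSet_generateFrom rfl))

/-- Strong law of large numbers for the frequency of pairwise independent, equally likely events. -/
theorem ae_tendsto_frequency [IsProbabilityMeasure μ] {E : ℕ → Set Ω} {p : ℝ}
    (hE : ∀ i, MeasurableSet (E i)) (hp : ∀ i, μ.real (E i) = p)
    (hindep : Pairwise fun i j => IndepSet (E i) (E j) μ) :
    ∀ᵐ ω ∂μ, Tendsto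
      (fun M : ℕ => (∑ i ∈ Finset.range M, (E i).indicator (1 : Ω → ℝ) ω) / (M : ℝ)) atTop
      (𝓝 p) := by
  have h := strong_law_ae_real (μ := μ) (fun i => (E i).indicator (1 : Ω → ℝ))
    ((integrable_const (1 : ℝ)).indicator (hE 0))
    (fun i j hij => indepFun_indicator_one (hindep hij))
    (fun i => identDistrib_indicator_one (hE i) (hE 0) <| by
      rw [← ENNReal.toReal_eq_toReal_iff' (measure_ne_top _ _) (measure_ne_top _ _)]
      exact (hp i).trans (hp 0).symm)
  rwa [integral_indicator_one (hE 0), hp 0] at h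

end Independence

/-! ### Survival products -/

section Survival

variable (D : ℕ → ℝ) (T : ℕ)

/-- Probability that at a slot congruent to `s` modulo the round length `T` no data of age less
than `κ` is available, if data of age `d` has been delivered with probability `D d`. -/
noncomputable def survival (κ s : ℕ) : ℝ :=
  ∏ d ∈ Finset.range κ, if d % T = s % T then 1 - D d else 1

variable {D T}

theorem survival_congr {κ s s' : ℕ} (h : s % T = s' % T) :
    survival D T κ s = survival D T κ s' := by
  simp only [survival, h]

/-- Among the T consecutive ages κ, …, κ + T - 1 exactly one, namely d, is congruent to s, so a full
period contributes exactly one factor. -/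
theorem survival_add_period {κ d s : ℕ} (h₁ : κ ≤ d) (h₂ : d < κ + T)
    (h : d % T = s % T) : survival D T (κ + T) s = survival D T κ s * (1 - D d) := by
  obtain ⟨x, rfl⟩ := Nat.exists_eq_add_of_le h₁
  rw [survival, Finset.prod_range_add, ← survival]
  congr 1
  rw [Finset.prod_eq_single_of_mem x (Finset.mem_range.2 (by lia)), if_pos h]
  intro y hy hyx
  rw [if_neg]
  intro h'
  have h3 : (κ + y) ≡ (κ + x) [MOD T] := h'.trans h.symm
  have h4 := Nat.ModEq.add_left_cancel' κ h3
  exact hyx (Nat.ModEq.eq_of_lt_of_lt h4 (Finset.mem_range.1 hy) (by lia))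

theorem survival_succ (κ s : ℕ) : survival D T (κ + 1) s =
    survival D T κ s - if κ % T = s % T then D κ * survival D T κ κ else 0 := by
  rw [survival, Finset.prod_range_succ, ← survival]
  split_ifs with h
  · rw [survival_congr h]; ring
  · ring

/-- Telescoping in κ: the new age κ affects only the residue class of κ, which loses `D κ * survival
D T κ κ`. This identity links slot frequencies to cycle means. -/
theorem sum_survival (hT : 0 < T) (κ : ℕ) : ∑ s ∈ Finset.range T, survival D T κ s =
    T - ∑ a ∈ Finset.range κ, D a * survival D T a a := by
  induction κ with
  | zero => simp [survival]
  | succ κ ih =>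
    simp_rw [survival_succ]
    rw [Finset.sum_sub_distrib, ih, Finset.sum_range_succ,
      Finset.sum_eq_single_of_mem (κ % T) (Finset.mem_range.2 (Nat.mod_lt _ hT)),
      if_pos (Nat.mod_mod _ _).symm]
    · ring
    · intro s hs hne
      rw [if_neg]
      rw [Nat.mod_eq_of_lt (Finset.mem_range.1 hs)]
      exact hne.symm

theorem survival_nonneg (hD : ∀ d, D d ≤ 1) (κ s : ℕ) : 0 ≤ survival D T κ s := by
  refine Finset.prod_nonneg fun d _ => ?_
  split_ifs
  · linarith [hD d]
  · exact zero_le_one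

/-- Every period after the first contributes a factor 1 - p. In the first period D need not have
reached p, so its factors are only bounded by 1. -/
theorem survival_mul_period_le {p : ℝ} (hD0 : ∀ d, 0 ≤ D d) (hD : ∀ d, D d ≤ 1)
    (hp : ∀ d, T ≤ d → D d = p) {s : ℕ} (hs : s < T) (M : ℕ) :
    survival D T ((M + 1) * T) s ≤ (1 - p) ^ M := by
  induction M with
  | zero =>
    refine Finset.prod_le_one (fun d _ => ?_) (fun d _ => ?_) <;> split_ifs <;>
      linarith [hD d, hD0 d]
  | succ M ih =>
    rw [Nat.succ_mul, survival_add_period (d := (M + 1) * T + s) (by lia) (by lia)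
      (by simp), hp _ (by nlinarith), pow_succ]
    have : p ≤ 1 := by rw [← hp T le_rfl]; exact hD T
    exact mul_le_mul_of_nonneg_right ih (by linarith)

/-- By `sum_survival` the defect of a partial sum from T is the total survival over one period,
which decays geometrically. Partial sums are monotone, so it suffices to take the limit along
multiples of T. -/
theorem hasSum_mul_survival {p : ℝ} (hT : 0 < T) (hD0 : ∀ d, 0 ≤ D d) (hD : ∀ d, D d ≤ 1)
    (hp : ∀ d, T ≤ d → D d = p) (hp0 : 0 < p) :
    HasSum (fun a => D a * survival D T a a) T := by
  have hnonneg : ∀ a, 0 ≤ D a * survival D T a a := fun a =>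
    mul_nonneg (hD0 a) (survival_nonneg hD _ _)
  rw [hasSum_iff_tendsto_nat_of_nonneg hnonneg]
  have hmono : Monotone fun n => ∑ a ∈ Finset.range n, D a * survival D T a a :=
    monotone_nat_of_le_succ fun n => by
      rw [Finset.sum_range_succ]; linarith [hnonneg n]
  have hsub : Tendsto (fun M : ℕ => (M + 1) * T) atTop atTop :=
    (tendsto_add_atTop_nat 1).atTop_mul_const' hT
  rw [tendsto_iff_tendsto_subseq_of_monotone hmono hsub]
  have hp1 : p ≤ 1 := by rw [← hp T le_rfl]; exact hD T
  have h0 : Tendsto (fun M : ℕ => ∑ s ∈ Finset.range T, survival D T ((M + 1) * T) s) atTop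
      (𝓝 0) := by
    have : Tendsto (fun M : ℕ => ∑ s ∈ Finset.range T, (1 - p) ^ M) atTop (𝓝 0) := by
      have h := tendsto_finsetSum (Finset.range T) fun s _ =>
        tendsto_pow_atTop_nhds_zero_of_lt_one (r := 1 - p) (by linarith) (by linarith)
      simpa using h
    refine squeeze_zero (fun M => Finset.sum_nonneg fun s _ => survival_nonneg hD _ _)
      (fun M => Finset.sum_le_sum fun s hs => ?_) this
    exact survival_mul_period_le hD0 hD hp (Finset.mem_range.1 hs) M
  have h1 := (tendsto_const_nhds (x := (T : ℝ))).sub h0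
  rw [sub_zero] at h1
  refine h1.congr fun M => ?_
  rw [sum_survival hT]
  simp

end Survival

/-! ### Lag sequences -/

section Lag

variable {Ω : Type*}

/-- Independent, identically distributed delivery lags of rounds of length `T`; the lag `0` stands
for a round without delivery. -/
structure IsLagSequence [MeasurableSpace Ω] (μ : Measure Ω) (lag : ℕ → Ω → ℕ) (T : ℕ)
    (D : ℕ → ℝ) : Prop where
  pos : 0 < T
  measurable : ∀ j, Measurable (lag j)
  indep : iIndepFun lag μ
  prob : ∀ j d, μ.real {ω | lag j ω ∈ Set.Icc 1 d} = D d
  lag_le : ∀ j ω, lag j ω ≤ T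
  prob_pos : 0 < D T

/-- The rounds whose data would have age less than `κ` at time `t`. -/
def ageWindow (T t κ : ℕ) : Finset ℕ :=
  (Finset.range (t + 1)).filter fun j => j * T ≤ t ∧ t < j * T + κ

/-- No data of age less than `κ` is available at time `t`. -/
def staleSet (lag : ℕ → Ω → ℕ) (T t κ : ℕ) : Set Ω :=
  {ω | ∀ j ∈ ageWindow T t κ, lag j ω ∉ Set.Icc 1 (t - j * T)}

/-- Exactly `k` of the first `i` rounds deliver. -/
def countSet (lag : ℕ → Ω → ℕ) (i k : ℕ) : Set Ω :=
  {ω | Nat.count (fun j => lag j ω ≠ 0) i = k}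

/-- The data of the `k`-th delivering round is the most recent available data when it has
age `a`. -/
def currentSet (lag : ℕ → Ω → ℕ) (T k a : ℕ) : Set Ω :=
  ⋃ i, countSet lag i k ∩ ({ω | lag i ω ∈ Set.Icc 1 a} ∩ staleSet lag T (i * T + a) a)

variable {lag : ℕ → Ω → ℕ} {T : ℕ} {D : ℕ → ℝ}

theorem mem_ageWindow (hT : 0 < T) {t κ j : ℕ} :
    j ∈ ageWindow T t κ ↔ j * T ≤ t ∧ t < j * T + κ := by
  rw [ageWindow, Finset.mem_filter, Finset.mem_range, and_iff_right_iff_imp]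
  rintro ⟨h, -⟩
  nlinarith

/-- The σ-algebra generated by the lags of the rounds in `S`. -/
@[reducible]
def lagAlgebra (lag : ℕ → Ω → ℕ) (S : Set ℕ) : MeasurableSpace Ω :=
  ⨆ j ∈ S, MeasurableSpace.comap (lag j) inferInstance

theorem measurable_lagAlgebra {S : Set ℕ} {j : ℕ} (hj : j ∈ S) :
    Measurable[lagAlgebra lag S] (lag j) :=
  Measurable.mono (comap_measurable (lag j))
    (le_biSup (fun j => MeasurableSpace.comap (lag j) inferInstance) hj) le_rfl

theorem measurableSet_lagAlgebra {S : Set ℕ} {j : ℕ} (hj : j ∈ S) (A : Set ℕ) :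
    MeasurableSet[lagAlgebra lag S] {ω | lag j ω ∈ A} :=
  measurable_lagAlgebra hj A.to_countable.measurableSet

theorem measurableSet_staleSet {S : Set ℕ} {t κ : ℕ} (h : ↑(ageWindow T t κ) ⊆ S) :
    MeasurableSet[lagAlgebra lag S] (staleSet lag T t κ) := by
  have : staleSet lag T t κ =
      ⋂ j ∈ ageWindow T t κ, {ω | lag j ω ∈ (Set.Icc 1 (t - j * T))ᶜ} := by
    ext; simp [staleSet]
  rw [this]
  exact Finset.measurableSet_biInter _ fun j hj => measurableSet_lagAlgebra (h hj) _

/-- Measurability with respect to the rounds before i, rather than all rounds, is what makes the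
count independent of round i and everything later. -/
theorem measurableSet_countSet (i k : ℕ) :
    MeasurableSet[lagAlgebra lag (Set.Iio i)] (countSet lag i k) := by
  have h : ∀ n ≤ i, Measurable[lagAlgebra lag (Set.Iio i)]
      fun ω => Nat.count (fun j => lag j ω ≠ 0) n := by
    intro n
    induction n with
    | zero => intro _; simp only [Nat.count_zero]; exact measurable_const
    | succ n ih =>
      intro hn
      simp only [Nat.count_succ]
      refine Measurable.add (ih (by lia)) (Measurable.ite ?_ measurable_const measurable_const)
      exact measurableSet_lagAlgebra (S := Set.Iio i) (Set.mem_Iio.2 (by lia)) {0}ᶜ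
  exact h i le_rfl (measurableSet_singleton k)

namespace IsLagSequence

variable [mΩ : MeasurableSpace Ω] {μ : Measure Ω}

theorem lagAlgebra_le (h : IsLagSequence μ lag T D) (S : Set ℕ) : lagAlgebra lag S ≤ mΩ :=
  iSup₂_le fun j _ => (h.measurable j).comap_le

theorem measurableSet_staleSet (h : IsLagSequence μ lag T D)
    (t κ : ℕ) : MeasurableSet (staleSet lag T t κ) :=
  h.lagAlgebra_le _ _ (_root_.measurableSet_staleSet (Set.subset_univ _))

theorem measurableSet_countSet (h : IsLagSequence μ lag T D)
    (i k : ℕ) : MeasurableSet (countSet lag i k) :=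
  h.lagAlgebra_le _ _ (_root_.measurableSet_countSet i k)

theorem measurableSet_lag (h : IsLagSequence μ lag T D)
    (j : ℕ) (A : Set ℕ) : MeasurableSet {ω | lag j ω ∈ A} :=
  h.measurable j A.to_countable.measurableSet

theorem measurableSet_currentSet (h : IsLagSequence μ lag T D)
    (k a : ℕ) : MeasurableSet (currentSet lag T k a) :=
  .iUnion fun i => (h.measurableSet_countSet i k).inter
    ((h.measurableSet_lag i _).inter (h.measurableSet_staleSet _ _))

theorem indep_lagAlgebra (h : IsLagSequence μ lag T D) {S S' : Set ℕ} (hS : Disjoint S S') :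
    Indep (lagAlgebra lag S) (lagAlgebra lag S') μ :=
  indep_iSup_of_disjoint (fun j => (h.measurable j).comap_le) h.indep.iIndep hS

theorem isProbabilityMeasure (h : IsLagSequence μ lag T D)
    : IsProbabilityMeasure μ := h.indep.isProbabilityMeasure

theorem prob_eq (h : IsLagSequence μ lag T D)
    (j d : ℕ) : μ {ω | lag j ω ∈ Set.Icc 1 d} = ENNReal.ofReal (D d) := by
  have := h.isProbabilityMeasure
  rw [← h.prob j d, ofReal_measureReal]

theorem nonneg (h : IsLagSequence μ lag T D)
    (d : ℕ) : 0 ≤ D d := by rw [← h.prob 0 d]; exact measureReal_nonneg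

theorem le_one (h : IsLagSequence μ lag T D) (d : ℕ) : D d ≤ 1 := by
  have := h.isProbabilityMeasure
  rw [← h.prob 0 d]; exact measureReal_le_one

theorem eq_of_le (h : IsLagSequence μ lag T D) {d : ℕ} (hd : T ≤ d) : D d = D T := by
  rw [← h.prob 0 d, ← h.prob 0 T]
  congr 1
  ext ω
  have := h.lag_le 0 ω
  simp only [Set.mem_Icc, Set.mem_ofPred_eq]
  lia

/-- The rounds in the window correspond to the ages d = t - j * T below κ that are congruent to t.
The bound on κ ensures that every such age belongs to an actual round, none starting before time 0.
-/
theorem measureReal_staleSet (h : IsLagSequence μ lag T D) {t κ : ℕ} (hκ : κ ≤ t + 1) :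
    μ.real (staleSet lag T t κ) = survival D T κ t := by
  have := h.isProbabilityMeasure
  have h1 : staleSet lag T t κ =
      ⋂ j ∈ ageWindow T t κ, lag j ⁻¹' (Set.Icc 1 (t - j * T))ᶜ := by
    ext; simp [staleSet]
  rw [h1, measureReal_def, h.indep.measure_inter_preimage_eq_mul _
    (fun j _ => (Set.to_countable _).measurableSet), ENNReal.toReal_prod]
  have h2 : ∀ j d, (μ (lag j ⁻¹' (Set.Icc 1 d)ᶜ)).toReal = 1 - D d := fun j d => by
    rw [Set.preimage_compl, ← measureReal_def,
      probReal_compl_eq_one_sub (h.measurable j measurableSet_Icc), ← h.prob j d]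
    rfl
  simp_rw [h2]
  rw [survival, ← Finset.prod_filter]
  have hT := h.pos
  refine Finset.prod_bij' (fun j _ => t - j * T) (fun d _ => (t - d) / T) ?_ ?_ ?_ ?_ ?_
  · intro j hj
    rw [mem_ageWindow hT] at hj
    rw [Finset.mem_filter, Finset.mem_range]
    refine ⟨by lia, ?_⟩
    obtain ⟨s, rfl⟩ := Nat.exists_eq_add_of_le hj.1
    simp
  · intro d hd
    rw [Finset.mem_filter, Finset.mem_range] at hd
    have h3 : (t - d) / T * T = t - d := Nat.div_mul_cancel
      ((Nat.modEq_iff_dvd' (by lia)).1 hd.2)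
    rw [mem_ageWindow hT, h3]
    lia
  · intro j hj
    rw [mem_ageWindow hT] at hj
    rw [Nat.sub_sub_self hj.1, Nat.mul_div_cancel _ hT]
  · intro d hd
    rw [Finset.mem_filter, Finset.mem_range] at hd
    have h3 : (t - d) / T * T = t - d := Nat.div_mul_cancel
      ((Nat.modEq_iff_dvd' (by lia)).1 hd.2)
    rw [h3]
    lia
  · intro j hj
    rfl

theorem indepSet_staleSet (h : IsLagSequence μ lag T D) {t t' κ : ℕ} (ht : t + κ ≤ t') :
    IndepSet (staleSet lag T t κ) (staleSet lag T t' κ) μ := by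
  have := h.isProbabilityMeasure
  have hdisj : Disjoint (ageWindow T t κ : Set ℕ) (ageWindow T t' κ) := by
    rw [Set.disjoint_left]
    intro j hj hj'
    rw [Finset.mem_coe, mem_ageWindow h.pos] at hj hj'
    lia
  exact (h.indep_lagAlgebra hdisj).indepSet_of_measurableSet
    (_root_.measurableSet_staleSet subset_rfl) (_root_.measurableSet_staleSet subset_rfl)

/-- The long-run frequency of slots without data of age less than `κ`. -/
theorem ae_tendsto_staleSet (h : IsLagSequence μ lag T D) (κ : ℕ) : ∀ᵐ ω ∂μ, Tendsto
    (fun M : ℕ => (∑ t ∈ Finset.range M, (staleSet lag T t κ).indicator (1 : Ω → ℝ) ω) / (M : ℝ))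
    atTop (𝓝 ((∑ s ∈ Finset.range T, survival D T κ s) / T)) := by
  have := h.isProbabilityMeasure
  have hT := h.pos
  -- As a multiple of T, the step Q keeps the events of one residue class equally likely; as Q ≥ κ,
  -- their windows are disjoint. The shift by κ * T below preserves residues modulo T and keeps the
  -- windows from being cut off at time 0.
  set Q := (κ + 1) * T with hQ
  have hQκ : κ ≤ Q := by nlinarith
  have hQ0 : 0 < Q := by positivity
  have h1 : ∀ r, ∀ᵐ ω ∂μ, Tendsto (fun M : ℕ => (∑ i ∈ Finset.range M,
      (staleSet lag T (r + i * Q + κ * T) κ).indicator (1 : Ω → ℝ) ω) / (M : ℝ)) atTop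
      (𝓝 (survival D T κ r)) := by
    intro r
    refine ae_tendsto_frequency (fun i => h.measurableSet_staleSet _ _) (fun i => ?_) ?_
    · rw [h.measureReal_staleSet (by nlinarith)]
      refine survival_congr ?_
      rw [hQ, ← mul_assoc, Nat.add_mul_mod_self_right, Nat.add_mul_mod_self_right]
    · have hlt : ∀ i j, i < j → IndepSet (staleSet lag T (r + i * Q + κ * T) κ)
          (staleSet lag T (r + j * Q + κ * T) κ) μ := fun i j hij => by
        refine h.indepSet_staleSet ?_
        have : (i + 1) * Q ≤ j * Q := Nat.mul_le_mul_right _ hij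
        nlinarith
      intro i j hij
      rcases hij.lt_or_gt with hij | hij
      · exact hlt i j hij
      · exact (hlt j i hij).symm
  filter_upwards [ae_all_iff.2 h1] with ω hω
  refine tendsto_cesaro_of_shift (κ * T) ?_
  have h2 := tendsto_cesaro_of_residues
    (u := fun t => (staleSet lag T (t + κ * T) κ).indicator (1 : Ω → ℝ) ω)
    hQ0 (fun t => ?_) (fun r _ => hω r)
  · convert h2 using 2
    rw [hQ, sum_range_mul_eq_sum_residues]
    have h3 : ∀ r i, survival D T κ (r + i * T) = survival D T κ r := fun r i =>
      survival_congr (Nat.add_mul_mod_self_right _ _ _)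
    simp_rw [h3]
    rw [Finset.sum_congr rfl fun r _ => Finset.sum_const _]
    rw [← Finset.smul_sum, Finset.card_range, nsmul_eq_mul]
    have : (T : ℝ) ≠ 0 := by exact_mod_cast hT.ne'
    push_cast
    field_simp
  · by_cases hm : ω ∈ staleSet lag T (t + κ * T) κ <;> simp [hm]

/-- The long-run average probability of having no data of age less than `κ`. -/
theorem tendsto_measureReal_staleSet (h : IsLagSequence μ lag T D) (κ : ℕ) : Tendsto
    (fun M : ℕ => (∑ t ∈ Finset.range M, μ.real (staleSet lag T t κ)) / (M : ℝ))
    atTop (𝓝 ((∑ s ∈ Finset.range T, survival D T κ s) / T)) := by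
  have := h.isProbabilityMeasure
  refine tendsto_cesaro_congr (u := survival D T κ) κ
    (fun t ht => (h.measureReal_staleSet (by lia)).symm) ?_
  refine tendsto_cesaro_of_residues h.pos (fun t => ?_) fun r _ => ?_
  · rw [← survival_congr (Nat.add_mul_mod_self_right t κ T),
      ← h.measureReal_staleSet (by nlinarith [h.pos]), abs_of_nonneg measureReal_nonneg]
    exact measureReal_le_one
  · have h3 : ∀ i, survival D T κ (r + i * T) = survival D T κ r := fun i =>
      survival_congr (Nat.add_mul_mod_self_right _ _ _)
    simp_rw [h3]
    refine tendsto_const_nhds.congr' ?_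
    filter_upwards [eventually_gt_atTop 0] with M hM
    have : (M : ℝ) ≠ 0 := by exact_mod_cast hM.ne'
    simp [this]

end IsLagSequence

end Lag

/-! ### Update cycles and their mean lengths -/

section Renewal

variable {Ω : Type*} {lag : ℕ → Ω → ℕ} {T : ℕ} {D : ℕ → ℝ}

/-- The `k`-th delivering round. -/
noncomputable def deliveryRound (lag : ℕ → Ω → ℕ) (k : ℕ) (ω : Ω) : ℕ :=
  Nat.nth (fun j => lag j ω ≠ 0) k

/-- Time from the start of the `k`-th delivering round to the next delivery. -/
noncomputable def peakAge (lag : ℕ → Ω → ℕ) (T k : ℕ) (ω : Ω) : ℕ :=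
  (deliveryRound lag (k + 1) ω - deliveryRound lag k ω) * T + lag (deliveryRound lag (k + 1) ω) ω

theorem pairwise_disjoint_countSet (k : ℕ) :
    Pairwise fun i j => Disjoint (countSet lag i k ∩ {ω | lag i ω ≠ 0})
      (countSet lag j k ∩ {ω | lag j ω ≠ 0}) := by
  have hlt : ∀ i j, i < j → Disjoint (countSet lag i k ∩ {ω | lag i ω ≠ 0})
      (countSet lag j k ∩ {ω | lag j ω ≠ 0}) := fun i j hij => by
    rw [Set.disjoint_left]
    rintro ω ⟨hi : Nat.count _ i = k, hi' : lag i ω ≠ 0⟩ ⟨hj : Nat.count _ j = k, -⟩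
    have h1 := Nat.count_monotone (fun j => lag j ω ≠ 0) (Nat.succ_le_of_lt hij)
    rw [Nat.succ_eq_add_one, Nat.count_succ, if_pos hi'] at h1
    lia
  intro i j hij
  rcases hij.lt_or_gt with hij | hij
  · exact hlt i j hij
  · exact (hlt j i hij).symm

theorem mem_countSet_inter_iff {ω : Ω} (hinf : {j | lag j ω ≠ 0}.Infinite) {i k : ℕ} :
    ω ∈ countSet lag i k ∩ {ω | lag i ω ≠ 0} ↔ i = deliveryRound lag k ω := by
  constructor
  · rintro ⟨rfl, hi⟩
    exact (Nat.nth_count (p := fun j => lag j ω ≠ 0) hi).symm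
  · rintro rfl
    exact ⟨Nat.count_nth_of_infinite hinf k, Nat.nth_mem_of_infinite hinf k⟩

/-- The data of round i is superseded exactly at the delivery of the next delivering round i'. Since
lags are at most T, a round after i' cannot deliver before i' does, so later rounds need no separate
check. -/
theorem mem_currentSet_iff {ω : Ω} (hT : 0 < T) (hle : ∀ j, lag j ω ≤ T)
    (hinf : {j | lag j ω ≠ 0}.Infinite) {k a : ℕ} :
    ω ∈ currentSet lag T k a ↔
      lag (deliveryRound lag k ω) ω ≤ a ∧ a < peakAge lag T k ω := by
  set i := deliveryRound lag k ω with hi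
  set i' := deliveryRound lag (k + 1) ω with hi'
  have hii' : i < i' := Nat.nth_strictMono hinf (Nat.lt_succ_self k)
  have hpi : lag i ω ≠ 0 := Nat.nth_mem_of_infinite hinf k
  have hpi' : lag i' ω ≠ 0 := Nat.nth_mem_of_infinite hinf (k + 1)
  have hnext : ∀ j, i < j → lag j ω ≠ 0 → i' ≤ j := fun j hij hj => by
    by_contra hlt
    exact absurd (Nat.le_nth_of_lt_nth_succ (p := fun j => lag j ω ≠ 0) (not_le.1 hlt) hj)
      (not_le.2 hij)
  have h1 : ω ∈ currentSet lag T k a ↔ lag i ω ≤ a ∧ ω ∈ staleSet lag T (i * T + a) a := by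
    rw [currentSet, Set.mem_iUnion]
    constructor
    · rintro ⟨n, hn, hna, hst⟩
      obtain rfl : n = i := (mem_countSet_inter_iff hinf).1
        ⟨hn, (Nat.one_le_iff_ne_zero.1 hna.1 : lag n ω ≠ 0)⟩
      exact ⟨hna.2, hst⟩
    · rintro ⟨ha, hst⟩
      exact ⟨i, ((mem_countSet_inter_iff hinf).2 rfl).1, ⟨Nat.one_le_iff_ne_zero.2 hpi, ha⟩, hst⟩
  rw [h1]
  refine and_congr_right fun _ => ?_
  obtain ⟨r, hr⟩ := Nat.exists_eq_add_of_lt hii'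
  have hpk : peakAge lag T k ω = (r + 1) * T + lag i' ω := by
    rw [peakAge, ← hi, ← hi', hr]
    congr 2
    lia
  have hmul : i' * T = i * T + (r + 1) * T := by rw [hr]; ring
  rw [hpk]
  constructor
  · intro hst
    by_contra hlt
    refine hst i' ?_ ⟨Nat.one_le_iff_ne_zero.2 hpi', ?_⟩
    · rw [mem_ageWindow hT]
      have : 0 < (r + 1) * T := by positivity
      lia
    · lia
  · rintro hlt j hj ⟨hj1, hj2⟩
    rw [mem_ageWindow hT] at hj
    have hij : i < j := by
      by_contra hji
      have := Nat.mul_le_mul_right T (not_lt.1 hji)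
      lia
    rcases (hnext j hij (Nat.one_le_iff_ne_zero.1 hj1)).eq_or_lt with rfl | hlt'
    · lia
    · have h2 := Nat.mul_le_mul_right T (Nat.succ_le_of_lt hlt')
      rw [Nat.succ_mul] at h2
      have := hle i'
      lia

/-- The sum counts the ages from `max z κ` up to, but excluding, the peak age; truncated subtraction
covers the case of none. -/
theorem tsum_indicator_currentSet {ω : Ω} (hT : 0 < T) (hle : ∀ j, lag j ω ≤ T)
    (hinf : {j | lag j ω ≠ 0}.Infinite) (k κ : ℕ) :
    ∑' a, (currentSet lag T k (a + κ)).indicator (1 : Ω → ENNReal) ω =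
      ((peakAge lag T k ω - max (lag (deliveryRound lag k ω) ω) κ : ℕ) : ENNReal) := by
  classical
  set z := lag (deliveryRound lag k ω) ω
  set w := peakAge lag T k ω
  have h1 : ∀ a, (currentSet lag T k (a + κ)).indicator (1 : Ω → ENNReal) ω =
      if a ∈ Finset.Ico (z - κ) (w - κ) then 1 else 0 := fun a => by
    rw [Set.indicator_apply]
    refine if_congr ?_ rfl rfl
    rw [mem_currentSet_iff hT hle hinf, Finset.mem_Ico]
    lia
  simp_rw [h1]
  rw [tsum_eq_sum (s := Finset.Ico (z - κ) (w - κ)) fun a ha => if_neg ha,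
    Finset.sum_congr rfl fun a ha => if_pos ha, Finset.sum_const, Nat.card_Ico, nsmul_one]
  congr 1
  lia

namespace IsLagSequence

variable [mΩ : MeasurableSpace Ω] {μ : Measure Ω}

theorem setOf_ne_zero_eq (h : IsLagSequence μ lag T D)
    (i : ℕ) : {ω | lag i ω ≠ 0} = {ω | lag i ω ∈ Set.Icc 1 T} := by
  ext ω
  have := h.lag_le i ω
  simp only [Set.mem_Icc, Set.mem_ofPred_eq]
  lia

theorem measure_ne_zero (h : IsLagSequence μ lag T D)
    (i : ℕ) : μ {ω | lag i ω ≠ 0} = ENNReal.ofReal (D T) := by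
  rw [h.setOf_ne_zero_eq, h.prob_eq]

/-- Second Borel–Cantelli lemma: the rounds deliver independently with the same positive
probability. -/
theorem ae_infinite (h : IsLagSequence μ lag T D) : ∀ᵐ ω ∂μ, {j | lag j ω ≠ 0}.Infinite := by
  have := h.isProbabilityMeasure
  have hmeas : ∀ j, MeasurableSet {ω | lag j ω ≠ 0} := fun j => h.measurableSet_lag j {0}ᶜ
  have hind : iIndepSet (fun j => {ω | lag j ω ≠ 0}) μ := by
    rw [iIndepSet_iff_meas_biInter hmeas]
    intro s
    exact h.indep.measure_inter_preimage_eq_mul s (sets := fun _ => {0}ᶜ)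
      fun _ _ => (measurableSet_singleton 0).compl
  have h1 := measure_limsup_eq_one hmeas hind (by
    simp_rw [h.measure_ne_zero]
    exact ENNReal.tsum_const_eq_top_of_ne_zero (ENNReal.ofReal_pos.2 h.prob_pos).ne')
  have h2 : ∀ᵐ ω ∂μ, ω ∈ limsup (fun j => {ω | lag j ω ≠ 0}) atTop :=
    (mem_ae_iff_prob_eq_one (MeasurableSet.measurableSet_limsup hmeas)).2 h1
  filter_upwards [h2] with ω hω
  rw [mem_limsup_iff_frequently_mem] at hω
  exact Nat.frequently_atTop_iff_infinite.1 hω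

theorem measure_countSet_inter (h : IsLagSequence μ lag T D)
    {S : Set ℕ} {A : Set Ω} {i k : ℕ} (hS : S ⊆ Set.Ici i)
    (hA : MeasurableSet[lagAlgebra lag S] A) :
    μ (countSet lag i k ∩ A) = μ (countSet lag i k) * μ A := by
  have hdisj : Disjoint (Set.Iio i) S :=
    Set.disjoint_left.2 fun j hj hj' => absurd (Set.mem_Ici.1 (hS hj')) (not_le.2 hj)
  have hind := h.indep_lagAlgebra hdisj
  rw [Indep_iff] at hind
  exact hind _ _ (_root_.measurableSet_countSet i k) hA

/-- Almost surely exactly one round i is the k-th delivering one. For it, the count before i is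
independent of the delivery in round i, which has probability D T. -/
theorem tsum_measure_countSet (h : IsLagSequence μ lag T D) (k : ℕ) :
    (∑' i, μ (countSet lag i k)) * ENNReal.ofReal (D T) = 1 := by
  have := h.isProbabilityMeasure
  rw [← ENNReal.tsum_mul_right, ← measure_univ (μ := μ)]
  have h1 : ∀ i, μ (countSet lag i k) * ENNReal.ofReal (D T) =
      μ (countSet lag i k ∩ {ω | lag i ω ≠ 0}) := fun i => by
    rw [h.measure_countSet_inter (S := {i}) (A := {ω | lag i ω ≠ 0}) (by simp)
      (measurableSet_lagAlgebra (Set.mem_singleton i) {0}ᶜ), h.measure_ne_zero]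
  simp_rw [h1]
  rw [← measure_iUnion (pairwise_disjoint_countSet k)
    fun i => (h.measurableSet_countSet i k).inter (h.measurableSet_lag i {0}ᶜ)]
  refine measure_congr (eventuallyEq_univ.2 ?_)
  filter_upwards [h.ae_infinite] with ω hω
  exact Set.mem_iUnion.2 ⟨_, (mem_countSet_inter_iff hω).2 rfl⟩

theorem measure_currentSet (h : IsLagSequence μ lag T D) (k a : ℕ) : μ (currentSet lag T k a) =
    ENNReal.ofReal (D a * survival D T a a / D T) := by
  have := h.isProbabilityMeasure
  have h1 : ∀ i, μ (countSet lag i k ∩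
      ({ω | lag i ω ∈ Set.Icc 1 a} ∩ staleSet lag T (i * T + a) a)) =
      μ (countSet lag i k) * ENNReal.ofReal (D a * survival D T a a) := fun i => by
    -- Data younger than age a at time i * T + a was generated strictly after round i.
    have hw : (ageWindow T (i * T + a) a : Set ℕ) ⊆ Set.Ioi i := fun j hj => by
      rw [Finset.mem_coe, mem_ageWindow h.pos] at hj
      have : i * T < j * T := by lia
      exact lt_of_mul_lt_mul_right this (Nat.zero_le T)
    rw [h.measure_countSet_inter (S := Set.Ici i) subset_rfl
      (MeasurableSet.inter (measurableSet_lagAlgebra (Set.mem_Ici.2 le_rfl) _)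
        (_root_.measurableSet_staleSet (hw.trans Set.Ioi_subset_Ici_self))),
      (Indep_iff _ _ μ).1 (h.indep_lagAlgebra (S := {i}) (S' := Set.Ioi i) (by simp)) _ _
      (measurableSet_lagAlgebra (Set.mem_singleton i) _) (_root_.measurableSet_staleSet hw),
      h.prob_eq, ENNReal.ofReal_mul (h.nonneg a),
      ← ofReal_measureReal (μ := μ) (s := staleSet lag T (i * T + a) a),
      h.measureReal_staleSet (by lia)]
    rw [survival_congr (s := i * T + a) (s' := a) (by simp)]
  rw [currentSet, measure_iUnion _ fun i => (h.measurableSet_countSet i k).inter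
    ((h.measurableSet_lag i _).inter (h.measurableSet_staleSet _ _))]
  · simp_rw [h1]
    rw [ENNReal.tsum_mul_right, ENNReal.ofReal_div_of_pos h.prob_pos,
      ENNReal.eq_div_iff (ENNReal.ofReal_pos.2 h.prob_pos).ne' ENNReal.ofReal_ne_top, ← mul_assoc,
      mul_comm (ENNReal.ofReal (D T)), h.tsum_measure_countSet, one_mul]
  · refine fun i j hij => (pairwise_disjoint_countSet (lag := lag) k hij).mono ?_ ?_ <;>
    exact Set.inter_subset_inter_right _ fun ω hω => Nat.one_le_iff_ne_zero.1 hω.1.1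

theorem lintegral_peakAge_sub (h : IsLagSequence μ lag T D) (k κ : ℕ) :
    ∫⁻ ω, ∑' a, (currentSet lag T k (a + κ)).indicator (1 : Ω → ENNReal) ω ∂μ =
      ENNReal.ofReal
        ((T - ∑ a ∈ Finset.range κ, D a * survival D T a a) / D T) := by
  rw [lintegral_tsum fun a =>
    (measurable_one.indicator (h.measurableSet_currentSet k (a + κ))).aemeasurable]
  simp_rw [lintegral_indicator_one (h.measurableSet_currentSet _ _), h.measure_currentSet]
  have h1 : HasSum (fun a => D (a + κ) * survival D T (a + κ) (a + κ))
      (T - ∑ a ∈ Finset.range κ, D a * survival D T a a) :=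
    (hasSum_nat_add_iff' (f := fun a => D a * survival D T a a) κ).2
      (hasSum_mul_survival h.pos h.nonneg h.le_one (fun d hd => h.eq_of_le hd) h.prob_pos)
  have h2 := h1.div_const (D T)
  rw [← h2.tsum_eq, ENNReal.ofReal_tsum_of_nonneg _ h2.summable]
  intro a
  exact div_nonneg (mul_nonneg (h.nonneg _) (survival_nonneg h.le_one _ _)) h.prob_pos.le

/-- Mean number of slots between consecutive deliveries in which the age is at least `κ`. -/
theorem integral_peakAge_sub (h : IsLagSequence μ lag T D) (k κ : ℕ) :
    Integrable (fun ω => ((peakAge lag T k ω - max (lag (deliveryRound lag k ω) ω) κ : ℕ) : ℝ)) μ ∧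
    ∫ ω, ((peakAge lag T k ω - max (lag (deliveryRound lag k ω) ω) κ : ℕ) : ℝ) ∂μ =
      (T - ∑ a ∈ Finset.range κ, D a * survival D T a a) / D T := by
  -- The series is measurable without further argument and agrees with the natural-number difference
  -- off the null set where only finitely many rounds deliver.
  set f : Ω → ENNReal := fun ω => ∑' a, (currentSet lag T k (a + κ)).indicator 1 ω
  have hf : Measurable f := Measurable.tsum fun a =>
    measurable_one.indicator (h.measurableSet_currentSet k (a + κ))
  have hlin : ∫⁻ ω, f ω ∂μ = _ := h.lintegral_peakAge_sub k κ
  have hne : ∫⁻ ω, f ω ∂μ ≠ ⊤ := by rw [hlin]; exact ENNReal.ofReal_ne_top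
  have hae : (fun ω => (f ω).toReal) =ᵐ[μ]
      fun ω => ((peakAge lag T k ω - max (lag (deliveryRound lag k ω) ω) κ : ℕ) : ℝ) := by
    filter_upwards [h.ae_infinite] with ω hω
    simp only [f]
    rw [tsum_indicator_currentSet h.pos (fun j => h.lag_le j ω) hω, ENNReal.toReal_natCast]
  refine ⟨(integrable_toReal_of_lintegral_ne_top hf.aemeasurable hne).congr hae, ?_⟩
  rw [← integral_congr_ae hae, integral_toReal hf.aemeasurable (ae_lt_top hf hne), hlin,
    ENNReal.toReal_ofReal]
  rw [← sum_survival h.pos]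
  exact div_nonneg (Finset.sum_nonneg fun s _ => survival_nonneg h.le_one _ _) h.prob_pos.le

end IsLagSequence

end Renewal

/-! ### The lags of the network -/

instance : Finite Mode :=
  Finite.of_surjective (fun b : Bool => cond b Mode.ec Mode.lc) fun m => by
    cases m
    · exact ⟨true, rfl⟩
    · exact ⟨false, rfl⟩

/-- The round to which a primitive random variable belongs. -/
def Source.round : Source → ℕ
  | .sense j => j
  | .comp j => j
  | .sinr j _ => j

namespace Network

variable (N : Network)

section Lags

variable {Ω : Type*} (ξ : (i : Source) → Ω → i.Val)

open Classical in
/-- Time from the start of round `j` to the update it causes, and `0` if it causes none. -/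
noncomputable def lag (j : ℕ) (ω : Ω) : ℕ := if N.Success ξ j ω then N.delay ξ j ω else 0

variable {N ξ}

theorem lag_eq_delay {j : ℕ} {ω : Ω} (h : N.Success ξ j ω) : N.lag ξ j ω = N.delay ξ j ω :=
  if_pos h

theorem lag_ne_zero_iff {j : ℕ} {ω : Ω} : N.lag ξ j ω ≠ 0 ↔ N.Success ξ j ω := by
  rw [lag]
  split_ifs with h
  · simp only [delay, h, iff_true]; lia
  · simp [h]

theorem lag_mem_Icc_iff {j d : ℕ} {ω : Ω} :
    N.lag ξ j ω ∈ Set.Icc 1 d ↔ N.Success ξ j ω ∧ N.delay ξ j ω ≤ d := by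
  rw [Set.mem_Icc, Nat.one_le_iff_ne_zero, lag_ne_zero_iff]
  exact and_congr_right fun h => by rw [lag_eq_delay h]

theorem attempts_spec {j : ℕ} {ω : Ω} (h : N.Success ξ j ω) :
    1 ≤ N.attempts ξ j ω ∧ N.attempts ξ j ω ≤ N.δ ∧
      ¬ N.Outage ξ (mode ξ j ω) j (N.attempts ξ j ω) ω := by
  obtain ⟨-, c, hc1, hcδ, hc⟩ := h
  have hmem := Nat.sInf_mem
    (s := {c | 1 ≤ c ∧ ¬ N.Outage ξ (mode ξ j ω) j c ω}) ⟨c, hc1, hc⟩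
  exact ⟨hmem.1, le_trans (Nat.sInf_le ⟨hc1, hc⟩) hcδ, hmem.2⟩

theorem two_add_le_delay {j : ℕ} {ω : Ω} (h : N.Success ξ j ω) :
    2 + N.τ (mode ξ j ω) ≤ N.delay ξ j ω := by
  have := (attempts_spec h).1
  rw [delay]
  lia

theorem lag_le (hround : ∀ m, 1 + N.δ + N.τ m ≤ N.τr) (j : ℕ) (ω : Ω) :
    N.lag ξ j ω ≤ N.τr := by
  rw [lag]
  split_ifs with h
  · have := (attempts_spec h).2.1
    have := hround (mode ξ j ω)
    rw [delay]
    lia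
  · exact Nat.zero_le _

/-- Number of transmission attempts in mode `m` that end at most `d` slots after the start of the
round. -/
def attemptBound (N : Network) (m : Mode) (d : ℕ) : ℕ := min (d - 1 - N.τ m) N.δ

/-- The first success comes among the first b attempts iff some success does. This removes the
infimum in `attempts` and leaves an event in the primitive variables. -/
theorem lag_mem_Icc_iff_exists {j d : ℕ} {ω : Ω} :
    N.lag ξ j ω ∈ Set.Icc 1 d ↔ (ξ (.sense j) ω : Bool) = true ∧ ∃ m, (ξ (.comp j) ω : Mode) = m ∧
      ∃ c ∈ Finset.Icc 1 (N.attemptBound m d), ¬ N.Outage ξ m j c ω := by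
  rw [lag_mem_Icc_iff]
  constructor
  · rintro ⟨h, hd⟩
    have hs := attempts_spec h
    refine ⟨h.1, _, rfl, N.attempts ξ j ω, ?_, hs.2.2⟩
    rw [delay, mode] at hd
    rw [Finset.mem_Icc, attemptBound]
    lia
  · rintro ⟨h, m, rfl, c, hc, hout⟩
    rw [Finset.mem_Icc, attemptBound] at hc
    refine ⟨⟨h, c, hc.1, by lia, hout⟩, ?_⟩
    have : N.attempts ξ j ω ≤ c := Nat.sInf_le ⟨hc.1, hout⟩
    rw [delay, mode]
    lia

theorem measurableSet_outage [MeasurableSpace Ω] {m : Mode} {j c : ℕ}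
    (h : Measurable (ξ (.sinr j c))) : MeasurableSet {ω | N.Outage ξ m j c ω} := by
  have h' : Measurable fun ω => (ξ (.sinr j c) ω : ℝ) := h
  exact measurableSet_lt ((Real.measurable_log.comp (h'.const_add 1)).div_const _ |>.const_mul _)
    measurable_const

/-- The σ-algebra is left arbitrary so that it can be the one generated by the variables of round j
alone, as the independence of the lags requires. -/
theorem measurable_lag {mΩ : MeasurableSpace Ω} {j : ℕ}
    (h : ∀ i : Source, i.round = j → Measurable (ξ i)) : Measurable (N.lag ξ j) := by
  have hIcc : ∀ d, MeasurableSet {ω | N.lag ξ j ω ∈ Set.Icc 1 d} := fun d => by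
    have heq : {ω | N.lag ξ j ω ∈ Set.Icc 1 d} = ξ (.sense j) ⁻¹' {true} ∩
        ⋃ m, ξ (.comp j) ⁻¹' {m} ∩ ⋃ c ∈ Finset.Icc 1 (N.attemptBound m d),
          {ω | N.Outage ξ m j c ω}ᶜ := by
      ext ω
      rw [Set.mem_ofPred_eq, lag_mem_Icc_iff_exists]
      simp
    rw [heq]
    refine (h (.sense j) rfl (measurableSet_singleton (α := Bool) true)).inter
      (.iUnion fun m => (h (.comp j) rfl (MeasurableSpace.measurableSet_top (α := Mode))).inter
        (Finset.measurableSet_biUnion _ fun c _ =>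
          (measurableSet_outage (h (.sinr j c) rfl)).compl))
  refine measurable_to_countable' fun z => ?_
  have heq : N.lag ξ j ⁻¹' {z} =
      if z = 0 then (⋃ d, {ω | N.lag ξ j ω ∈ Set.Icc 1 d})ᶜ
      else {ω | N.lag ξ j ω ∈ Set.Icc 1 z} \ {ω | N.lag ξ j ω ∈ Set.Icc 1 (z - 1)} := by
    ext ω
    split_ifs with hz
    · subst hz
      simp only [Set.mem_preimage, Set.mem_singleton_iff, Set.mem_compl_iff, Set.mem_iUnion,
        Set.mem_ofPred_eq, Set.mem_Icc, not_exists, not_and]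
      exact ⟨fun h0 => by lia, fun h0 => by
        by_contra hne
        exact h0 _ (Nat.one_le_iff_ne_zero.2 hne) le_rfl⟩
    · simp only [Set.mem_preimage, Set.mem_singleton_iff, Set.mem_sdiff, Set.mem_ofPred_eq,
        Set.mem_Icc]
      lia
  rw [heq]
  split_ifs
  · exact (MeasurableSet.iUnion hIcc).compl
  · exact (hIcc z).diff (hIcc (z - 1))

end Lags

/-- Probability of each computing mode. -/
def modeProb : Mode → ℝ
  | .ec => N.pe
  | .lc => 1 - N.pe

/-- Probability that a round causes an update at most `d` slots after its start. -/
noncomputable def deliveryProb (d : ℕ) : ℝ :=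
  N.ps * (N.modeProb .ec * N.ζ .ec (N.attemptBound .ec d) +
    N.modeProb .lc * N.ζ .lc (N.attemptBound .lc d))

namespace IsModel

variable {N} {Ω : Type*} [mΩ : MeasurableSpace Ω] {μ : Measure Ω}
  {ξ : (i : Source) → Ω → i.Val}

theorem iIndepFun_lag (h : N.IsModel ξ μ) : iIndepFun (N.lag ξ) μ := by
  have := h.indep.isProbabilityMeasure
  have h1 := iIndep_iSup_fiber (fun i => (h.measurable i).comap_le) h.indep.iIndep Source.round
  rw [iIndep_iff] at h1
  rw [iIndepFun_iff_measure_inter_preimage_eq_mul]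
  intro S A hA
  refine h1 S fun j hj => ?_
  refine measurable_lag (mΩ := ⨆ i ∈ {i : Source | i.round = j},
    MeasurableSpace.comap (ξ i) inferInstance) (fun i hi => ?_) (hA j hj)
  exact Measurable.mono (comap_measurable (ξ i))
    (le_biSup (fun i => MeasurableSpace.comap (ξ i) inferInstance) hi) le_rfl

theorem measureReal_comp (h : N.IsModel ξ μ) (m : Mode) (j : ℕ) :
    μ.real {ω | (ξ (.comp j) ω : Mode) = m} = N.modeProb m := by
  have := h.indep.isProbabilityMeasure
  cases m with
  | ec => exact h.comp_prob j
  | lc =>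
    have hmeas : MeasurableSet {ω | (ξ (.comp j) ω : Mode) = Mode.ec} :=
      h.measurable (.comp j) (MeasurableSpace.measurableSet_top (α := Mode) (s := {Mode.ec}))
    have heq : {ω | (ξ (.comp j) ω : Mode) = Mode.lc} =
        {ω | (ξ (.comp j) ω : Mode) = Mode.ec}ᶜ := by
      ext ω
      simp only [Set.mem_ofPred_eq, Set.mem_compl_iff]
      cases (ξ (.comp j) ω : Mode) <;> simp
    rw [heq, probReal_compl_eq_one_sub hmeas, h.comp_prob, modeProb]

/-- With the mode fixed, the event constrains finitely many primitive variables separately, so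
independence yields the product. -/
theorem measureReal_outages (h : N.IsModel ξ μ) (m : Mode) (j b : ℕ) :
    μ.real {ω | (ξ (.sense j) ω : Bool) = true ∧ (ξ (.comp j) ω : Mode) = m ∧
      ∀ c ∈ Finset.Icc 1 b, N.Outage ξ m j c ω} = N.ps * N.modeProb m * N.po m ^ b := by
  classical
  have := h.indep.isProbabilityMeasure
  let A : (i : Source) → Set i.Val := fun i => match i with
    | .sense _ => ({true} : Set Bool)
    | .comp _ => ({m} : Set Mode)
    | .sinr _ _ => {x : ℝ | N.W * Real.logb 2 (1 + x) < N.R m}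
  have hA : ∀ i, MeasurableSet (A i) := fun i => match i with
    | .sense _ => measurableSet_singleton (α := Bool) true
    | .comp _ => MeasurableSpace.measurableSet_top (α := Mode)
    | .sinr _ _ => measurableSet_lt
        ((Real.measurable_log.comp (measurable_id.const_add (1 : ℝ))).div_const _ |>.const_mul _)
        measurable_const
  let S : Finset Source :=
    insert (.sense j) (insert (.comp j) ((Finset.Icc 1 b).image (Source.sinr j)))
  have heq : {ω | (ξ (.sense j) ω : Bool) = true ∧ (ξ (.comp j) ω : Mode) = m ∧
      ∀ c ∈ Finset.Icc 1 b, N.Outage ξ m j c ω} = ⋂ i ∈ S, ξ i ⁻¹' A i := by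
    ext ω
    simp only [S, Finset.mem_insert, Finset.mem_image, Set.mem_iInter]
    constructor
    · rintro ⟨h1, h2, h3⟩ i (rfl | rfl | ⟨c, hc, rfl⟩)
      · exact h1
      · exact h2
      · exact h3 c hc
    · intro H
      exact ⟨H _ (.inl rfl), H _ (.inr (.inl rfl)), fun c hc => H _ (.inr (.inr ⟨c, hc, rfl⟩))⟩
  rw [heq, measureReal_def, h.indep.measure_inter_preimage_eq_mul S fun i _ => hA i,
    ENNReal.toReal_prod, Finset.prod_insert (by simp), Finset.prod_insert (by simp),
    Finset.prod_image fun c _ c' _ hcc => by simpa using hcc, ← mul_assoc]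
  congr 1
  · congr 1
    · exact h.sense_prob j
    · exact h.measureReal_comp m j
  · have : ∀ c, (μ (ξ (.sinr j c) ⁻¹' A (.sinr j c))).toReal = N.po m := fun c =>
      h.outage_prob m j c
    simp [this]

theorem measureReal_mode_delivered (h : N.IsModel ξ μ) (m : Mode) (j b : ℕ) :
    μ.real {ω | (ξ (.sense j) ω : Bool) = true ∧ (ξ (.comp j) ω : Mode) = m ∧
      ∃ c ∈ Finset.Icc 1 b, ¬ N.Outage ξ m j c ω} = N.ps * (N.modeProb m * N.ζ m b) := by
  have := h.indep.isProbabilityMeasure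
  have hmeas : MeasurableSet {ω | (ξ (.sense j) ω : Bool) = true ∧ (ξ (.comp j) ω : Mode) = m ∧
      ∀ c ∈ Finset.Icc 1 b, N.Outage ξ m j c ω} := by
    refine (h.measurable (.sense j) (measurableSet_singleton (α := Bool) true)).inter
      ((h.measurable (.comp j) (MeasurableSpace.measurableSet_top (α := Mode) (s := {m}))).inter ?_)
    have heq : {ω | ∀ c ∈ Finset.Icc 1 b, N.Outage ξ m j c ω} =
        ⋂ c ∈ Finset.Icc 1 b, {ω | N.Outage ξ m j c ω} := by ext; simp
    change MeasurableSet {ω | ∀ c ∈ Finset.Icc 1 b, N.Outage ξ m j c ω}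
    rw [heq]
    exact Finset.measurableSet_biInter _ fun c _ => measurableSet_outage (h.measurable _)
  have h0 := h.measureReal_outages m j 0
  have hb := h.measureReal_outages m j b
  -- The case b = 0 imposes no outage condition, so some success means this event minus the event
  -- that all b attempts fail.
  have heq : {ω | (ξ (.sense j) ω : Bool) = true ∧ (ξ (.comp j) ω : Mode) = m ∧
      ∃ c ∈ Finset.Icc 1 b, ¬ N.Outage ξ m j c ω} =
      {ω | (ξ (.sense j) ω : Bool) = true ∧ (ξ (.comp j) ω : Mode) = m ∧
        ∀ c ∈ Finset.Icc 1 0, N.Outage ξ m j c ω} \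
      {ω | (ξ (.sense j) ω : Bool) = true ∧ (ξ (.comp j) ω : Mode) = m ∧
        ∀ c ∈ Finset.Icc 1 b, N.Outage ξ m j c ω} := by
    ext ω
    simp only [Set.mem_ofPred_eq, Set.mem_sdiff]
    have : ∀ c ∈ Finset.Icc 1 0, N.Outage ξ m j c ω := by simp
    push Not
    tauto
  rw [heq, measureReal_sdiff _ hmeas, h0, hb, ζ, zpow_natCast]
  · ring
  · rintro ω ⟨h1, h2, -⟩
    exact ⟨h1, h2, by simp⟩

theorem measureReal_lag (h : N.IsModel ξ μ) (j d : ℕ) :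
    μ.real {ω | N.lag ξ j ω ∈ Set.Icc 1 d} = N.deliveryProb d := by
  have := h.indep.isProbabilityMeasure
  have heq : {ω | N.lag ξ j ω ∈ Set.Icc 1 d} =
      {ω | (ξ (.sense j) ω : Bool) = true ∧ (ξ (.comp j) ω : Mode) = .ec ∧
        ∃ c ∈ Finset.Icc 1 (N.attemptBound .ec d), ¬ N.Outage ξ .ec j c ω} ∪
      {ω | (ξ (.sense j) ω : Bool) = true ∧ (ξ (.comp j) ω : Mode) = .lc ∧
        ∃ c ∈ Finset.Icc 1 (N.attemptBound .lc d), ¬ N.Outage ξ .lc j c ω} := by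
    ext ω
    rw [Set.mem_ofPred_eq, lag_mem_Icc_iff_exists]
    constructor
    · rintro ⟨h1, m, h2, h3⟩
      cases m
      · exact .inl ⟨h1, h2, h3⟩
      · exact .inr ⟨h1, h2, h3⟩
    · rintro (⟨h1, h2, h3⟩ | ⟨h1, h2, h3⟩)
      · exact ⟨h1, _, h2, h3⟩
      · exact ⟨h1, _, h2, h3⟩
  have hdisj : Disjoint
      {ω | (ξ (.sense j) ω : Bool) = true ∧ (ξ (.comp j) ω : Mode) = .ec ∧
        ∃ c ∈ Finset.Icc 1 (N.attemptBound .ec d), ¬ N.Outage ξ .ec j c ω}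
      {ω | (ξ (.sense j) ω : Bool) = true ∧ (ξ (.comp j) ω : Mode) = .lc ∧
        ∃ c ∈ Finset.Icc 1 (N.attemptBound .lc d), ¬ N.Outage ξ .lc j c ω} := by
    rw [Set.disjoint_left]
    rintro ω ⟨-, h1, -⟩ ⟨-, h2, -⟩
    exact Mode.noConfusion (h1.symm.trans h2)
  rw [heq, measureReal_union hdisj, h.measureReal_mode_delivered, h.measureReal_mode_delivered,
    deliveryProb, mul_add]
  have heq2 : {ω | (ξ (.sense j) ω : Bool) = true ∧ (ξ (.comp j) ω : Mode) = .lc ∧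
        ∃ c ∈ Finset.Icc 1 (N.attemptBound .lc d), ¬ N.Outage ξ .lc j c ω} =
      ξ (.sense j) ⁻¹' {true} ∩ (ξ (.comp j) ⁻¹' {Mode.lc} ∩
        ⋃ c ∈ Finset.Icc 1 (N.attemptBound .lc d), {ω | N.Outage ξ .lc j c ω}ᶜ) := by
    ext ω
    simp
  rw [heq2]
  exact (h.measurable (.sense j) (measurableSet_singleton (α := Bool) true)).inter
      ((h.measurable (.comp j) (MeasurableSpace.measurableSet_top (α := Mode))).inter
        (Finset.measurableSet_biUnion _ fun c _ => (measurableSet_outage (h.measurable _)).compl))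

theorem modeProb_nonneg (h : N.IsModel ξ μ) (m : Mode) : 0 ≤ N.modeProb m := by
  rw [← h.measureReal_comp m 0]
  exact measureReal_nonneg

theorem po_nonneg (h : N.IsModel ξ μ) (m : Mode) : 0 ≤ N.po m := by
  rw [← h.outage_prob m 0 0]
  exact measureReal_nonneg

end IsModel

theorem attemptBound_eq {d : ℕ} {m : Mode} (hd : 1 + N.δ + N.τ m ≤ d) :
    N.attemptBound m d = N.δ := by
  rw [attemptBound]
  lia

theorem deliveryProb_eq_px (hround : ∀ m, 1 + N.δ + N.τ m ≤ N.τr) {d : ℕ} (hd : N.τr ≤ d) :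
    N.deliveryProb d = N.px := by
  rw [deliveryProb, px, N.attemptBound_eq ((hround _).trans hd),
    N.attemptBound_eq ((hround _).trans hd), modeProb, modeProb]

theorem ζ_pos {m : Mode} (h0 : 0 ≤ N.po m) (h1 : N.po m < 1) {c : ℕ} (hc : c ≠ 0) :
    0 < N.ζ m c := by
  rw [ζ, zpow_natCast, sub_pos]
  exact pow_lt_one₀ h0 h1 hc

theorem successProb_pos (h0 : ∀ m, 0 ≤ N.po m) (hpo : ∀ m, N.po m < 1) (hδ : 1 ≤ N.δ)
    (hm : ∀ m, 0 ≤ N.modeProb m) : 0 < N.pe * N.ζ .ec N.δ + (1 - N.pe) * N.ζ .lc N.δ := by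
  have he := N.ζ_pos (h0 .ec) (hpo .ec) (c := N.δ) (by lia)
  have hl := N.ζ_pos (h0 .lc) (hpo .lc) (c := N.δ) (by lia)
  have h1 : 0 ≤ N.pe := hm .ec
  have h2 : 0 ≤ 1 - N.pe := hm .lc
  rcases h1.eq_or_lt with h1 | h1
  · rw [← h1]; simpa using hl
  · have := mul_pos h1 he
    have := mul_nonneg h2 hl.le
    linarith

theorem IsModel.isLagSequence {N : Network} {Ω : Type*} [MeasurableSpace Ω] {μ : Measure Ω}
    {ξ : (i : Source) → Ω → i.Val} (h : N.IsModel ξ μ) (hδ : 1 ≤ N.δ)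
    (hround : ∀ m, 1 + N.δ + N.τ m ≤ N.τr) (hps : 0 < N.ps) (hpo : ∀ m, N.po m < 1) :
    IsLagSequence μ (N.lag ξ) N.τr N.deliveryProb where
  pos := by have := hround .ec; lia
  measurable j := measurable_lag fun i _ => h.measurable i
  indep := h.iIndepFun_lag
  prob := h.measureReal_lag
  lag_le := N.lag_le hround
  prob_pos := by
    rw [N.deliveryProb_eq_px hround le_rfl]
    exact mul_pos hps (N.successProb_pos h.po_nonneg hpo hδ h.modeProb_nonneg)

end Network

/-! ### Age and update cycles in terms of lags -/

/-- The least natural number exceeding `v`. -/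
noncomputable def ageThreshold (v : ℝ) : ℕ := (⌊v⌋ + 1).toNat

theorem ageThreshold_le_iff {v : ℝ} {a : ℕ} : ageThreshold v ≤ a ↔ v < a := by
  rw [ageThreshold, Int.toNat_le, Int.add_one_le_iff, Int.floor_lt, Int.cast_natCast]

theorem natCast_ageThreshold {v : ℝ} (h : 0 < ageThreshold v) :
    (ageThreshold v : ℝ) = ⌊v⌋ + 1 := by
  have h1 : ((ageThreshold v : ℤ)) = ⌊v⌋ + 1 := by
    rw [ageThreshold] at h ⊢
    lia
  exact_mod_cast congrArg (Int.cast (R := ℝ)) h1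

namespace Network

variable {N : Network} {Ω : Type*} {ξ : (i : Source) → Ω → i.Val}

theorem lastGen_le_iff {t b : ℕ} {ω : Ω} : N.lastGen ξ t ω ≤ b ↔
    ∀ j ≤ t, N.Success ξ j ω → j * N.τr + N.delay ξ j ω ≤ t → j * N.τr ≤ b := by
  rw [lastGen, Finset.sup_le_iff]
  simp only [Finset.mem_filter, Finset.mem_range, Nat.lt_succ_iff]
  exact ⟨fun h j h1 h2 h3 => h j ⟨h1, h2, h3⟩, fun h j hj => h j hj.1 hj.2.1 hj.2.2⟩

theorem aoi_eq_natCast (t : ℕ) (ω : Ω) : N.aoi ξ t ω = ((t - N.lastGen ξ t ω : ℕ) : ℝ) := by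
  rw [aoi, Nat.cast_sub (lastGen_le_iff.2 fun j _ _ h => by lia)]

/-- From time `ageThreshold v` on, the initial data is itself older than v, so only delivered rounds
can keep the age at most v. -/
theorem setOf_lt_aoi_eq_staleSet (hτr : 0 < N.τr) {v : ℝ} {t : ℕ} (ht : ageThreshold v ≤ t) :
    {ω | v < N.aoi ξ t ω} = staleSet (N.lag ξ) N.τr t (ageThreshold v) := by
  ext ω
  have hle : N.lastGen ξ t ω ≤ t := lastGen_le_iff.2 fun j _ _ h => by lia
  rw [Set.mem_ofPred_eq, aoi_eq_natCast, ← ageThreshold_le_iff]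
  have h1 : ageThreshold v ≤ t - N.lastGen ξ t ω ↔ N.lastGen ξ t ω ≤ t - ageThreshold v := by lia
  rw [h1, lastGen_le_iff]
  constructor
  · intro h j hj hlag
    rw [mem_ageWindow hτr] at hj
    rw [lag_mem_Icc_iff] at hlag
    have := h j (by nlinarith) hlag.1 (by lia)
    lia
  · intro h j hj hs hd
    by_contra hlt
    refine h j ((mem_ageWindow hτr).2 (by lia)) (lag_mem_Icc_iff.2 ⟨hs, by lia⟩)

/-- Data at the sink is never younger than the shortest delay. -/
theorem exists_mode_le_aoi {t : ℕ} (ht : 2 + N.τ .ec ≤ t) (ω : Ω) :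
    ∃ m, (2 + N.τ m : ℝ) ≤ N.aoi ξ t ω := by
  classical
  by_cases h : ∃ j ≤ t, N.Success ξ j ω ∧ j * N.τr + N.delay ξ j ω ≤ t ∧
      N.lastGen ξ t ω = j * N.τr
  · obtain ⟨j, -, hs, hd, hj⟩ := h
    refine ⟨mode ξ j ω, ?_⟩
    rw [aoi_eq_natCast, hj]
    have := two_add_le_delay hs
    have h1 : 2 + N.τ (mode ξ j ω) ≤ t - j * N.τr := by lia
    exact_mod_cast h1
  -- Nothing has been delivered, and the age is t. The mode is an arbitrary witness, matched by the
  -- assumption on t.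
  · refine ⟨.ec, ?_⟩
    have h0 : N.lastGen ξ t ω = 0 := by
      rcases Finset.eq_empty_or_nonempty ((Finset.range (t + 1)).filter
        (fun j => N.Success ξ j ω ∧ j * N.τr + N.delay ξ j ω ≤ t)) with he | hne
      · rw [lastGen, he]; rfl
      · obtain ⟨j, hj, hj'⟩ := Finset.exists_mem_eq_sup _ hne (fun j => j * N.τr)
        rw [Finset.mem_filter, Finset.mem_range] at hj
        exact absurd ⟨j, by lia, hj.2.1, hj.2.2, hj'⟩ h
    rw [aoi_eq_natCast, h0]
    exact_mod_cast ht

section Cycle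

variable {ω : Ω}

theorem updateRound_eq (k : ℕ) : N.updateRound ξ k ω = deliveryRound (N.lag ξ) k ω := by
  rw [updateRound, deliveryRound]
  congr 1
  funext j
  exact propext lag_ne_zero_iff.symm

theorem Z_eq (hinf : {j | N.lag ξ j ω ≠ 0}.Infinite) (k : ℕ) :
    N.Z ξ k ω = N.lag ξ (deliveryRound (N.lag ξ) k ω) ω := by
  have h : N.Success ξ (deliveryRound (N.lag ξ) k ω) ω :=
    lag_ne_zero_iff.1 (Nat.nth_mem_of_infinite hinf k)
  rw [Z, updateRound_eq, lag_eq_delay h]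

theorem add_X_eq (hinf : {j | N.lag ξ j ω ≠ 0}.Infinite) (k : ℕ) :
    N.τr + N.X ξ (k + 1) ω = peakAge (N.lag ξ) N.τr k ω := by
  have hle : deliveryRound (N.lag ξ) k ω ≤ deliveryRound (N.lag ξ) (k + 1) ω :=
    (Nat.nth_strictMono hinf (Nat.lt_succ_self k)).le
  rw [X, updateTime, Z_eq hinf, updateRound_eq, updateRound_eq, peakAge, Nat.add_sub_cancel]
  push_cast [hle]
  ring

theorem le_peakAge (hround : ∀ m, 1 + N.δ + N.τ m ≤ N.τr)
    (hinf : {j | N.lag ξ j ω ≠ 0}.Infinite) (k : ℕ) :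
    N.lag ξ (deliveryRound (N.lag ξ) k ω) ω ≤ peakAge (N.lag ξ) N.τr k ω := by
  have hlt : deliveryRound (N.lag ξ) k ω < deliveryRound (N.lag ξ) (k + 1) ω :=
    Nat.nth_strictMono hinf (Nat.lt_succ_self k)
  have h1 := lag_le (ξ := ξ) hround (deliveryRound (N.lag ξ) k ω) ω
  rw [peakAge]
  have h2 : 1 * N.τr ≤
      (deliveryRound (N.lag ξ) (k + 1) ω - deliveryRound (N.lag ξ) k ω) * N.τr :=
    Nat.mul_le_mul_right _ (by lia)
  lia

theorem U_eq (hround : ∀ m, 1 + N.δ + N.τ m ≤ N.τr)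
    (hinf : {j | N.lag ξ j ω ≠ 0}.Infinite) (k : ℕ) :
    N.U ξ (k + 1) ω = ((peakAge (N.lag ξ) N.τr k ω -
      max (N.lag ξ (deliveryRound (N.lag ξ) k ω) ω) 0 : ℕ) : ℝ) := by
  rw [Nat.max_zero, Nat.cast_sub (le_peakAge hround hinf k), ← add_X_eq hinf, ← Z_eq hinf, U, X,
    Nat.add_sub_cancel, updateTime, updateTime]
  ring

/-- The three cases defining `g` merge into one truncated difference. In the middle case the
threshold exceeds the previous delay, hence is positive and equals ⌊v⌋ + 1. -/
theorem g_eq (hround : ∀ m, 1 + N.δ + N.τ m ≤ N.τr)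
    (hinf : {j | N.lag ξ j ω ≠ 0}.Infinite) (v : ℝ) (k : ℕ) :
    N.g ξ v (k + 1) ω = ((peakAge (N.lag ξ) N.τr k ω -
      max (N.lag ξ (deliveryRound (N.lag ξ) k ω) ω) (ageThreshold v) : ℕ) : ℝ) := by
  have hle := le_peakAge (ξ := ξ) hround hinf k
  rw [g, add_X_eq hinf, Nat.add_sub_cancel, Z_eq hinf]
  simp only [← ageThreshold_le_iff]
  split_ifs with h1 h2
  · rw [max_eq_left h1, Nat.cast_sub hle]
  · rw [max_eq_right (by lia), Nat.cast_sub h2, natCast_ageThreshold (by lia)]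
  · rw [max_eq_right (by lia), Nat.sub_eq_zero_of_le (by lia), Nat.cast_zero]

end Cycle

/-! ### Evaluation of the closed form -/

/-- Probability that a successful update in mode `m` takes at most `a` slots. -/
noncomputable def delayCDF (N : Network) (m : Mode) (a : ℕ) : ℝ :=
  N.ζ m (N.attemptBound m a) / N.ζ m N.δ

/-- Probability that the peak age of a cycle that ends with an update in mode `m` exceeds `a`. -/
noncomputable def peakTail (N : Network) (m : Mode) (a : ℕ) : ℝ :=
  if a < N.τr then 1 else (1 - N.px) ^ (a / N.τr - 1) * (1 - N.px * N.delayCDF m (a % N.τr))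

/-- Mean delay of a successful update in mode `m`. -/
noncomputable def meanDelay (N : Network) (m : Mode) : ℝ := 1 + N.τ m + N.F₁ m

theorem delayCDF_eq_zero {m : Mode} {a : ℕ} (h : a < 2 + N.τ m) : N.delayCDF m a = 0 := by
  have : N.attemptBound m a = 0 := by rw [attemptBound]; lia
  simp [delayCDF, this, ζ]

theorem delayCDF_eq_one {m : Mode} {a : ℕ} (hζ : N.ζ m N.δ ≠ 0) (h : 1 + N.δ + N.τ m ≤ a) :
    N.delayCDF m a = 1 := by
  rw [delayCDF, N.attemptBound_eq h, div_self hζ]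

theorem sum_one_sub_delayCDF {m : Mode} (hζ : N.ζ m N.δ ≠ 0) (h1 : N.po m < 1) {x : ℕ}
    (hx : x ≤ N.δ) : ∑ a ∈ Finset.range (1 + N.τ m + x), (1 - N.delayCDF m a) =
      1 + N.τ m + ((1 - N.po m ^ x) / (1 - N.po m) - x * N.po m ^ N.δ) / N.ζ m N.δ := by
  have h1' : 1 - N.po m ≠ 0 := by linarith
  induction x with
  | zero =>
    rw [add_zero, Finset.sum_congr rfl fun a ha => by
      rw [delayCDF_eq_zero (by have := Finset.mem_range.1 ha; lia), sub_zero]]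
    simp
  | succ x ih =>
    have hb : N.attemptBound m (1 + N.τ m + x) = x := by rw [attemptBound]; lia
    rw [← add_assoc, Finset.sum_range_succ, ih (by lia), delayCDF, hb]
    have h2 : N.ζ m x = 1 - N.po m ^ x := by rw [ζ, zpow_natCast]
    have h3 : N.ζ m N.δ = 1 - N.po m ^ N.δ := by rw [ζ, zpow_natCast]
    rw [h2]
    rw [h3] at hζ ⊢
    push_cast
    field_simp
    ring

theorem sum_one_sub_delayCDF_eq_meanDelay {m : Mode} (hζ : N.ζ m N.δ ≠ 0) (h1 : N.po m < 1)
    {κ : ℕ} (hκ : 1 + N.δ + N.τ m ≤ κ) :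
    ∑ a ∈ Finset.range κ, (1 - N.delayCDF m a) = N.meanDelay m := by
  have h1' : 1 - N.po m ≠ 0 := by linarith
  obtain ⟨s, rfl⟩ := Nat.exists_eq_add_of_le hκ
  rw [Finset.sum_range_add, Finset.sum_eq_zero (s := Finset.range s) fun a _ => by
    rw [delayCDF_eq_one hζ (by lia), sub_self], add_zero,
    show 1 + N.δ + N.τ m = 1 + N.τ m + N.δ by ring, sum_one_sub_delayCDF hζ h1 le_rfl, meanDelay,
    F₁]
  have h3 : N.ζ m N.δ = 1 - N.po m ^ N.δ := by rw [ζ, zpow_natCast]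
  have h4 : N.ζ m 1 = 1 - N.po m := by rw [ζ, zpow_one]
  rw [h4, h3]
  rw [h3] at hζ
  field_simp

theorem peakTail_of_lt {m : Mode} {a : ℕ} (h : a < N.τr) : N.peakTail m a = 1 := if_pos h

/-- Conditioning on the first round after the previous update: with probability px it delivers and
only its delay remains; otherwise the situation starts afresh one round later. -/
theorem peakTail_add (hround : ∀ m, 1 + N.δ + N.τ m ≤ N.τr) {m : Mode} (hζ : N.ζ m N.δ ≠ 0)
    (a : ℕ) : N.peakTail m (a + N.τr) =
      (1 - N.px) * N.peakTail m a + N.px * (1 - N.delayCDF m a) := by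
  have hτr : 0 < N.τr := by have := hround m; lia
  rw [peakTail, if_neg (by lia), Nat.add_div_right _ hτr, Nat.add_mod_right, Nat.succ_sub_one,
    peakTail]
  split_ifs with h
  · rw [Nat.div_eq_of_lt h, Nat.mod_eq_of_lt h]
    ring
  · obtain ⟨b, hb⟩ := Nat.exists_eq_succ_of_ne_zero (Nat.div_pos (not_lt.1 h) hτr).ne'
    rw [delayCDF_eq_one hζ (a := a) ((hround m).trans (not_lt.1 h)), hb, Nat.succ_sub_one, pow_succ]
    ring

theorem peakTail_eq_one (hδ : 1 ≤ N.δ) (hround : ∀ m, 1 + N.δ + N.τ m ≤ N.τr) {m : Mode}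
    (hζ : N.ζ m N.δ ≠ 0) {a : ℕ} (h : a < N.τr + 2 + N.τ m) : N.peakTail m a = 1 := by
  rcases lt_or_ge a N.τr with ha | ha
  · exact peakTail_of_lt ha
  · obtain ⟨b, rfl⟩ := Nat.exists_eq_add_of_le' ha
    rw [peakTail_add hround hζ, peakTail_of_lt (by have := hround m; lia),
      delayCDF_eq_zero (by lia)]
    ring

/-- Mean excess of the peak age over `κ` for cycles that end with an update in mode `m`. -/
noncomputable def meanExcess (N : Network) (m : Mode) (κ : ℕ) : ℝ :=
  N.τr / N.px + N.meanDelay m - ∑ a ∈ Finset.range κ, N.peakTail m a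

theorem meanExcess_eq (hδ : 1 ≤ N.δ) (hround : ∀ m, 1 + N.δ + N.τ m ≤ N.τr) {m : Mode}
    (hζ : N.ζ m N.δ ≠ 0) {κ : ℕ} (h : κ ≤ N.τr + 2 + N.τ m) :
    N.meanExcess m κ = N.τr / N.px + N.meanDelay m - κ := by
  rw [meanExcess, Finset.sum_congr rfl fun a ha => peakTail_eq_one hδ hround hζ
    ((Finset.mem_range.1 ha).trans_le h)]
  simp

/-- The recursion of `peakTail_add`, summed: a delivery in the first round leaves the mean excess of
the delay over κ. -/
theorem meanExcess_add (hround : ∀ m, 1 + N.δ + N.τ m ≤ N.τr) {m : Mode} (hζ : N.ζ m N.δ ≠ 0)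
    (hpx : N.px ≠ 0) (κ : ℕ) : N.meanExcess m (κ + N.τr) = (1 - N.px) * N.meanExcess m κ +
      N.px * (N.meanDelay m - ∑ a ∈ Finset.range κ, (1 - N.delayCDF m a)) := by
  rw [meanExcess, meanExcess, add_comm κ, Finset.sum_range_add,
    Finset.sum_congr rfl fun a ha => peakTail_of_lt (m := m) (Finset.mem_range.1 ha)]
  simp_rw [add_comm N.τr, peakTail_add hround hζ]
  rw [Finset.sum_add_distrib, ← Finset.mul_sum, ← Finset.mul_sum]
  simp only [Finset.sum_const, Finset.card_range, nsmul_eq_mul, mul_one]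
  field_simp
  ring

theorem meanExcess_add_mul (hδ : 1 ≤ N.δ) (hround : ∀ m, 1 + N.δ + N.τ m ≤ N.τr) {m : Mode}
    (hζ : N.ζ m N.δ ≠ 0) (h1 : N.po m < 1) (hpx : N.px ≠ 0) {κ : ℕ}
    (h : κ ≤ N.τr + 2 + N.τ m) (y : ℕ) :
    N.meanExcess m (κ + (y + 1) * N.τr) = (1 - N.px) ^ y *
      ((1 - N.px) * (N.τr / N.px + N.meanDelay m - κ) +
        N.px * (N.meanDelay m - ∑ a ∈ Finset.range κ, (1 - N.delayCDF m a))) := by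
  induction y with
  | zero => rw [zero_add, one_mul, meanExcess_add hround hζ hpx, meanExcess_eq hδ hround hζ h,
      pow_zero, one_mul]
  | succ y ih =>
    rw [Nat.succ_mul, ← add_assoc, meanExcess_add hround hζ hpx, ih,
      sum_one_sub_delayCDF_eq_meanDelay (κ := κ + (y + 1) * N.τr) hζ h1 (by
        have := hround m
        have := Nat.le_mul_of_pos_left N.τr (Nat.succ_pos y)
        lia), pow_succ]
    ring

theorem sum_delayCDF_mul_peakTail_eq_zero {m' m : Mode} {κ : ℕ} (h : κ ≤ 2 + N.τ m') :
    ∑ a ∈ Finset.range κ, N.delayCDF m' a * N.peakTail m a = 0 :=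
  Finset.sum_eq_zero fun a ha => by
    rw [delayCDF_eq_zero ((Finset.mem_range.1 ha).trans_le h), zero_mul]

/-- For a < τr the tail is 1, for a ≥ τr the distribution function is 1; so (1 - CDF)(1 - tail) = 0
termwise. -/
theorem sum_delayCDF_mul_peakTail (hround : ∀ m, 1 + N.δ + N.τ m ≤ N.τr) {m' m : Mode}
    (hζ : N.ζ m' N.δ ≠ 0) (κ : ℕ) :
    ∑ a ∈ Finset.range κ, N.delayCDF m' a * N.peakTail m a =
      ∑ a ∈ Finset.range κ, N.peakTail m a - ∑ a ∈ Finset.range κ, (1 - N.delayCDF m' a) := by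
  rw [← Finset.sum_sub_distrib]
  refine Finset.sum_congr rfl fun a _ => ?_
  rcases lt_or_ge a N.τr with ha | ha
  · rw [peakTail_of_lt ha]; ring
  · rw [delayCDF_eq_one hζ ((hround m').trans ha)]; ring

/-- For independent previous delay Z and peak age P, this is the mean of P - max(Z, κ), truncated at
0: the mean of P - Z minus the expected number of a < κ with Z ≤ a < P. The five cases of `G` record
how far κ reaches into the supports of Z and P. -/
theorem G_eq (hδ : 1 ≤ N.δ) (hround : ∀ m, 1 + N.δ + N.τ m ≤ N.τr)
    (hζ : ∀ m, N.ζ m N.δ ≠ 0) (hpo : ∀ m, N.po m < 1) (hpx : N.px ≠ 0) (v : ℝ) (m' m : Mode) :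
    N.G v m' m = N.τr / N.px + N.meanDelay m - N.meanDelay m' -
      ∑ a ∈ Finset.range (ageThreshold v), N.delayCDF m' a * N.peakTail m a := by
  have hτr : 0 < N.τr := by have := hround m; lia
  have hτr' : (0 : ℝ) < N.τr := by exact_mod_cast hτr
  have hζδ : ∀ m, N.ζ m N.δ = 1 - N.po m ^ N.δ := fun m => by rw [ζ, zpow_natCast]
  have hζ1 : ∀ m, N.ζ m 1 = 1 - N.po m := fun m => by rw [ζ, zpow_one]
  have hpo' : ∀ m, 1 - N.po m ≠ 0 := fun m => by linarith [hpo m]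
  simp only [G]
  by_cases h1 : v < N.v₁ m'
  · rw [if_pos h1, sum_delayCDF_mul_peakTail_eq_zero, meanDelay, meanDelay]
    · ring
    · rw [ageThreshold_le_iff]
      simpa [v₁] using h1
  rw [if_neg h1, sum_delayCDF_mul_peakTail hround (hζ m')]
  rw [v₁, not_lt] at h1
  have hv0 : 0 ≤ ⌊v⌋ := Int.floor_nonneg.2 (le_trans (by positivity) h1)
  obtain ⟨n, hn⟩ := Int.eq_ofNat_of_zero_le hv0
  have hκ : ageThreshold v = n + 1 := by rw [ageThreshold, hn]; lia
  have hlt : ∀ b : ℕ, v < b ↔ n < b := fun b => by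
    rw [← ageThreshold_le_iff, hκ, Nat.succ_le_iff]
  have h1' : 2 + N.τ m' ≤ n := by
    rw [← not_lt, ← hlt, not_lt]; push_cast; exact h1
  rw [hκ, hn, Int.cast_natCast]
  have hv2 : v < N.v₂ m' ↔ n < 1 + N.δ + N.τ m' := by rw [← hlt, v₂]; push_cast; rfl
  by_cases h2 : v < N.v₂ m'
  · rw [if_pos h2]
    rw [hv2] at h2
    -- Here a is the number of attempts that can finish by age n, the exponent in the second case of
    -- `G`.
    obtain ⟨a, rfl⟩ := Nat.exists_eq_add_of_le (show 1 + N.τ m' ≤ n by lia)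
    have ha : ((1 + N.τ m' + a : ℕ) : ℤ) - 1 - N.τ m' = (a : ℤ) := by push_cast; ring
    rw [ha, zpow_natCast, Finset.sum_congr rfl fun b hb => peakTail_of_lt (m := m) (N := N) (a := b)
      (by have := Finset.mem_range.1 hb; have := hround m'; lia), add_assoc (1 + N.τ m'),
      sum_one_sub_delayCDF (hζ m') (hpo m') (by lia), meanDelay, meanDelay, F₁, F₁, hζ1, hζ1]
    simp only [Finset.sum_const, Finset.card_range, nsmul_eq_mul, mul_one]
    have e1 := hζ m'
    have e2 := hζ m
    have e3 := hpo' m'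
    have e4 := hpo' m
    rw [hζδ] at e1 e2
    rw [hζδ, hζδ]
    push_cast
    field_simp
    ring
  rw [if_neg h2]
  rw [hv2, not_lt] at h2
  rw [sum_one_sub_delayCDF_eq_meanDelay (hζ m') (hpo m') (by lia)]
  have hfin : N.τr / N.px + N.meanDelay m - N.meanDelay m' -
      (∑ a ∈ Finset.range (n + 1), N.peakTail m a - N.meanDelay m') = N.meanExcess m (n + 1) := by
    rw [meanExcess]; ring
  rw [hfin]
  have hv3 : v < N.v₃ m 1 ↔ n < N.τr + 2 + N.τ m := by rw [← hlt, v₃]; push_cast; rw [one_mul]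
  by_cases h3 : v < N.v₃ m 1
  · rw [if_pos h3, meanExcess_eq hδ hround (hζ m) (by rw [hv3] at h3; lia), meanDelay]
    push_cast
    ring
  rw [if_neg h3]
  have h3' : (N.τr : ℝ) ≤ v - 2 - N.τ m := by
    rw [v₃, not_lt] at h3
    push_cast at h3
    linarith
  set y := N.yIdx v m with hy
  have hy1 : 1 ≤ y := by
    rw [hy, yIdx, Nat.one_le_floor_iff, one_le_div hτr']
    exact h3'
  have hy2 : (y : ℝ) * N.τr ≤ v - 2 - N.τ m := by
    rw [← le_div_iff₀ hτr']
    exact Nat.floor_le (div_nonneg (hτr'.le.trans h3') hτr'.le)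
  have hy3 : v - 2 - N.τ m < (y + 1 : ℝ) * N.τr := by
    rw [← div_lt_iff₀ hτr']
    exact Nat.lt_floor_add_one _
  have hy2' : y * N.τr + 2 + N.τ m ≤ n := by
    rw [← not_lt, ← hlt, not_lt]; push_cast; linarith
  have hy3' : n < (y + 1) * N.τr + 2 + N.τ m := by
    rw [← hlt]; push_cast; linarith
  obtain ⟨z, hz⟩ : ∃ z, y = z + 1 := ⟨y - 1, by lia⟩
  obtain ⟨x, hx⟩ := Nat.exists_eq_add_of_le (show y * N.τr + 1 + N.τ m ≤ n by lia)
  have hf : N.F₃ v m y = (x : ℤ) := by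
    rw [F₃, hn, hx]; push_cast; ring
  -- The threshold n + 1 is split into y = z + 1 whole rounds and a remainder on which the peak tail
  -- is still 1; x is the value of `F₃`.
  have hxz : n + 1 = 1 + N.τ m + (x + 1) + (z + 1) * N.τr := by rw [hx, hz]; ring
  have hxle : 1 + N.τ m + (x + 1) ≤ N.τr + 2 + N.τ m := by
    rw [Nat.succ_mul] at hy3'
    lia
  have hnx : (n : ℝ) = (z + 1) * N.τr + 1 + N.τ m + x := by
    rw [hx, hz]; push_cast; ring
  have hv4 : v < N.v₄ m y ↔ x < N.δ := by
    have : v < N.v₄ m y ↔ n < y * N.τr + 1 + N.δ + N.τ m := by rw [← hlt, v₄]; push_cast; rfl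
    rw [this]
    lia
  rw [hxz, meanExcess_add_mul hδ hround (hζ m) (hpo m) hpx hxle, hf, hz, Nat.add_sub_cancel]
  have e1 := hζ m
  have e2 := hpo' m
  rw [hζδ] at e1
  by_cases h4 : v < N.v₄ m y
  · rw [← hz, if_pos h4, sum_one_sub_delayCDF (hζ m) (hpo m) (by lia), hz]
    congr 1
    rw [zpow_natCast, meanDelay, F₁, F₂, hζ1, hζδ, ζ, zpow_natCast, hnx]
    push_cast
    field_simp
    ring
  -- Now x ≥ δ, so the remainder exceeds every possible delay and the mean excess of the delay
  -- vanishes.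
  · rw [← hz, if_neg h4, sum_one_sub_delayCDF_eq_meanDelay (hζ m) (hpo m) (by lia), hz, sub_self,
      mul_zero, add_zero, pow_succ, meanDelay, F₁, hζ1]
    rw [hζδ]
    push_cast
    field_simp
    ring

end Network

/-! ### Averaging over the modes of consecutive updates -/

namespace Network

variable {N : Network}

theorem pcond_add (h : N.pe * N.ζ .ec N.δ + (1 - N.pe) * N.ζ .lc N.δ ≠ 0) :
    N.pcond .ec + N.pcond .lc = 1 := by
  rw [pcond, pcond, ← add_div, div_self h]

theorem deliveryProb_eq_mul (h : N.pe * N.ζ .ec N.δ + (1 - N.pe) * N.ζ .lc N.δ ≠ 0)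
    (hζ : ∀ m, N.ζ m N.δ ≠ 0) (a : ℕ) : N.deliveryProb a =
      N.px * (N.pcond .ec * N.delayCDF .ec a + N.pcond .lc * N.delayCDF .lc a) := by
  have h1 := hζ .ec
  have h2 := hζ .lc
  rw [deliveryProb, px, pcond, pcond, delayCDF, delayCDF, modeProb, modeProb]
  field_simp

/-- Both sides satisfy the same recursion in steps of τr. For b < τr all tails are 1, and from τr on
all distribution functions are 1, so the mixture of the recursions never involves a product of
mode-dependent terms. -/
theorem survival_eq_peakTail (hround : ∀ m, 1 + N.δ + N.τ m ≤ N.τr)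
    (h : N.pe * N.ζ .ec N.δ + (1 - N.pe) * N.ζ .lc N.δ ≠ 0) (hζ : ∀ m, N.ζ m N.δ ≠ 0) (a : ℕ) :
    survival N.deliveryProb N.τr a a =
      N.pcond .ec * N.peakTail .ec a + N.pcond .lc * N.peakTail .lc a := by
  have hτr : 0 < N.τr := by have := hround .ec; lia
  induction a using Nat.strong_induction_on with
  | _ a ih =>
  have hsum := pcond_add h
  rcases lt_or_ge a N.τr with ha | ha
  · rw [peakTail_of_lt ha, peakTail_of_lt ha, mul_one, mul_one, hsum]
    refine Finset.prod_eq_one fun d hd => if_neg ?_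
    have hd := Finset.mem_range.1 hd
    rw [Nat.mod_eq_of_lt (hd.trans ha), Nat.mod_eq_of_lt ha]
    exact hd.ne
  · obtain ⟨b, rfl⟩ := Nat.exists_eq_add_of_le' ha
    rw [survival_add_period (d := b) le_rfl (by lia) (Nat.add_mod_right _ _).symm,
      survival_congr (Nat.add_mod_right b N.τr), ih b (by lia), peakTail_add hround (hζ _),
      peakTail_add hround (hζ _), deliveryProb_eq_mul h hζ]
    have hl : N.pcond .lc = 1 - N.pcond .ec := by linarith
    rcases lt_or_ge b N.τr with hb | hb
    · rw [peakTail_of_lt hb, peakTail_of_lt hb, hl]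
      ring
    · rw [delayCDF_eq_one (hζ _) ((hround _).trans hb),
        delayCDF_eq_one (hζ _) ((hround _).trans hb),
        hl]
      ring

theorem meanViolation_eq (hδ : 1 ≤ N.δ) (hround : ∀ m, 1 + N.δ + N.τ m ≤ N.τr)
    (h : N.pe * N.ζ .ec N.δ + (1 - N.pe) * N.ζ .lc N.δ ≠ 0) (hζ : ∀ m, N.ζ m N.δ ≠ 0)
    (hpo : ∀ m, N.po m < 1) (hpx : N.px ≠ 0) (v : ℝ) :
    N.meanViolation v = (N.τr - ∑ a ∈ Finset.range (ageThreshold v),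
      N.deliveryProb a * survival N.deliveryProb N.τr a a) / N.px := by
  have hK : ∑ a ∈ Finset.range (ageThreshold v),
      N.deliveryProb a * survival N.deliveryProb N.τr a a = N.px *
        (N.pcond .ec * N.pcond .ec *
            ∑ a ∈ Finset.range (ageThreshold v), N.delayCDF .ec a * N.peakTail .ec a +
          N.pcond .ec * N.pcond .lc *
            ∑ a ∈ Finset.range (ageThreshold v), N.delayCDF .ec a * N.peakTail .lc a +
          N.pcond .lc * N.pcond .ec *
            ∑ a ∈ Finset.range (ageThreshold v), N.delayCDF .lc a * N.peakTail .ec a +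
          N.pcond .lc * N.pcond .lc *
            ∑ a ∈ Finset.range (ageThreshold v), N.delayCDF .lc a * N.peakTail .lc a) := by
    simp only [Finset.mul_sum, ← Finset.sum_add_distrib]
    refine Finset.sum_congr rfl fun a _ => ?_
    rw [survival_eq_peakTail hround h hζ, deliveryProb_eq_mul h hζ]
    ring
  have hl : N.pcond .lc = 1 - N.pcond .ec := by linarith [pcond_add h]
  rw [hK, meanViolation]
  simp only [G_eq hδ hround hζ hpo hpx]
  rw [hl]
  field_simp
  ring

/-! ### Coverage -/

/-- Radius of the disc that data of age `a` covers. -/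
noncomputable def coverageRadius (N : Network) (a : ℝ) : ℝ :=
  (-(Real.log (1 - N.ε₀) / 2) - N.β₂ * a) / N.β₁

theorem coverage_eq_closedBall (hβ₁ : 0 < N.β₁) (hε₀ : N.ε₀ < 1) (a : ℝ) :
    N.coverage a = Metric.closedBall N.x (N.coverageRadius a) := by
  ext y
  have h1 : Real.exp (-N.β₁ * dist N.x y - N.β₂ * a) ^ 2 =
      Real.exp (2 * (-N.β₁ * dist N.x y - N.β₂ * a)) := by
    rw [← Real.exp_nat_mul]; norm_num
  rw [Metric.mem_closedBall, dist_comm, coverageRadius, le_div_iff₀ hβ₁]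
  change N.estError (dist N.x y) a ≤ N.ε₀ ↔ _
  rw [estError, h1, sub_le_comm, ← Real.log_le_iff_le_exp (by linarith)]
  constructor <;> intro h <;> linarith

theorem targetRadius_pos (hη : 0 < N.η) (harea : 0 < N.area) : 0 < N.targetRadius :=
  Real.sqrt_pos.2 (div_pos (mul_pos hη harea) Real.pi_pos)

theorem targetRadius_le_coverageRadius_iff (hβ₁ : 0 < N.β₁) (hβ₂ : 0 < N.β₂) {a : ℝ} :
    N.targetRadius ≤ N.coverageRadius a ↔ a ≤ N.vth := by
  have h1 : N.vth - a = N.β₁ / N.β₂ * (N.coverageRadius a - N.targetRadius) := by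
    rw [vth, coverageRadius]
    field_simp
    ring
  have h2 : 0 < N.β₁ / N.β₂ := div_pos hβ₁ hβ₂
  rw [← sub_nonneg, ← sub_nonneg (b := a), h1, mul_nonneg_iff_of_pos_left h2]

theorem measureReal_closedBall (r : ℝ) (hr : 0 ≤ r) (x : Plane) :
    volume.real (Metric.closedBall x r) = Real.pi * r ^ 2 := by
  rw [measureReal_def, EuclideanSpace.volume_closedBall_fin_two]
  simp [hr, Real.pi_pos.le, mul_comm]

theorem measureReal_closedBall_targetRadius (hη : 0 < N.η) (harea : 0 < N.area) :
    volume.real (Metric.closedBall N.x N.targetRadius) = N.η * N.area := by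
  rw [measureReal_closedBall _ (targetRadius_pos hη harea).le, targetRadius, Real.sq_sqrt
    (div_nonneg (mul_pos hη harea).le Real.pi_pos.le)]
  field_simp

/-- The ratio is compared through disc areas. A disc smaller than the target fails wherever Φ lies;
the inclusion enters for the converse, to place the target disc inside Φ. -/
theorem le_coverageRatio_iff (hβ₁ : 0 < N.β₁) (hβ₂ : 0 < N.β₂) (hε₀ : N.ε₀ < 1) (hη : 0 < N.η)
    (hΦ_pos : 0 < volume N.Φ) (hΦ_fin : volume N.Φ < ⊤) {a : ℝ}
    (hincl : N.coverage a ⊆ N.Φ ∨ Metric.closedBall N.x N.targetRadius ⊆ N.Φ) :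
    N.η ≤ N.coverageRatio a ↔ a ≤ N.vth := by
  have harea : 0 < N.area := ENNReal.toReal_pos hΦ_pos.ne' hΦ_fin.ne
  have hR := targetRadius_pos hη harea
  rw [coverageRatio, le_div_iff₀ harea, ← measureReal_closedBall_targetRadius hη harea,
    ← targetRadius_le_coverageRadius_iff hβ₁ hβ₂, coverage_eq_closedBall hβ₁ hε₀]
  rw [coverage_eq_closedBall hβ₁ hε₀] at hincl
  have hfin : volume (Metric.closedBall N.x (N.coverageRadius a) ∩ N.Φ) ≠ ⊤ :=
    measure_ne_top_of_subset Set.inter_subset_right hΦ_fin.ne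
  constructor
  · intro h
    by_contra! hlt
    refine absurd h (not_le.2 ?_)
    -- The coverage radius is negative for old data; it is replaced by its positive part before the
    -- area formula is applied.
    have h1 : volume.real (Metric.closedBall N.x (N.coverageRadius a) ∩ N.Φ) ≤
        volume.real (Metric.closedBall N.x (max (N.coverageRadius a) 0)) :=
      measureReal_mono (Set.inter_subset_left.trans
        (Metric.closedBall_subset_closedBall (le_max_left _ _)))
        Metric.isBounded_closedBall.measure_lt_top.ne
    refine h1.trans_lt ?_
    rw [measureReal_closedBall _ (le_max_right _ _), measureReal_closedBall _ hR.le]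
    exact mul_lt_mul_of_pos_left (pow_lt_pow_left₀ (max_lt hlt hR) (le_max_right _ _) two_ne_zero)
      Real.pi_pos
  · intro h
    refine measureReal_mono (Set.subset_inter (Metric.closedBall_subset_closedBall h) ?_) hfin
    exact hincl.elim (fun hc => (Metric.closedBall_subset_closedBall h).trans hc) id

end Network

/-! ### Steady-state probabilities -/

section SteadyState

variable {Ω : Type*}

theorem card_filter_eq_sum_indicator (E : ℕ → Set Ω) (ω : Ω) (T : ℕ)
    [DecidablePred fun t => ω ∈ E t] :
    (((Finset.range T).filter (fun t => ω ∈ E t)).card : ℝ) =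
      ∑ t ∈ Finset.range T, (E t).indicator (1 : Ω → ℝ) ω := by
  rw [Finset.card_filter, Nat.cast_sum]
  refine Finset.sum_congr rfl fun t _ => ?_
  by_cases h : ω ∈ E t <;> simp [h]

variable [MeasurableSpace Ω] {μ : Measure Ω}

theorem isSteadyStateProb_of_tendsto {E F : ℕ → Set Ω} {p : ℝ} (t₀ : ℕ)
    (hEF : ∀ t, t₀ ≤ t → F t = E t)
    (h₁ : Tendsto (fun T : ℕ => (∑ t ∈ Finset.range T, μ.real (E t)) / (T : ℝ)) atTop (𝓝 p))
    (h₂ : ∀ᵐ ω ∂μ, Tendsto (fun T : ℕ =>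
      (∑ t ∈ Finset.range T, (E t).indicator (1 : Ω → ℝ) ω) / (T : ℝ)) atTop (𝓝 p)) :
    IsSteadyStateProb μ F p := by
  refine ⟨tendsto_cesaro_congr t₀ (fun t ht => by rw [hEF t ht]) h₁, ?_⟩
  filter_upwards [h₂] with ω hω
  simp_rw [card_filter_eq_sum_indicator]
  exact tendsto_cesaro_congr t₀ (fun t ht => by rw [hEF t ht]) hω

theorem tendsto_cesaro_one_sub {u : ℕ → ℝ} {p : ℝ}
    (h : Tendsto (fun T : ℕ => (∑ t ∈ Finset.range T, u t) / (T : ℝ)) atTop (𝓝 p)) :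
    Tendsto (fun T : ℕ => (∑ t ∈ Finset.range T, (1 - u t)) / (T : ℝ)) atTop (𝓝 (1 - p)) := by
  refine (tendsto_const_nhds.sub h).congr' ?_
  filter_upwards [eventually_gt_atTop 0] with T hT
  have : (T : ℝ) ≠ 0 := by exact_mod_cast hT.ne'
  rw [Finset.sum_sub_distrib, sub_div]
  simp [this]

theorem isSteadyStateProb_compl [IsProbabilityMeasure μ] {E F : ℕ → Set Ω} {p : ℝ} (t₀ : ℕ)
    (hE : ∀ t, MeasurableSet (E t)) (hEF : ∀ t, t₀ ≤ t → F t = (E t)ᶜ)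
    (h₁ : Tendsto (fun T : ℕ => (∑ t ∈ Finset.range T, μ.real (E t)) / (T : ℝ)) atTop (𝓝 p))
    (h₂ : ∀ᵐ ω ∂μ, Tendsto (fun T : ℕ =>
      (∑ t ∈ Finset.range T, (E t).indicator (1 : Ω → ℝ) ω) / (T : ℝ)) atTop (𝓝 p)) :
    IsSteadyStateProb μ F (1 - p) := by
  refine isSteadyStateProb_of_tendsto t₀ hEF ?_ ?_
  · simp_rw [fun t => probReal_compl_eq_one_sub (μ := μ) (hE t)]
    exact tendsto_cesaro_one_sub h₁
  · filter_upwards [h₂] with ω hω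
    have hc : ∀ t, (E t)ᶜ.indicator (1 : Ω → ℝ) ω = 1 - (E t).indicator (1 : Ω → ℝ) ω := fun t => by
      by_cases h : ω ∈ E t <;> simp [h]
    simp_rw [hc]
    exact tendsto_cesaro_one_sub hω

end SteadyState

theorem mainTheorem3 {Ω : Type*} [MeasurableSpace Ω] (μ : Measure Ω) [IsProbabilityMeasure μ]
    (N : Network) (ξ : (i : Source) → Ω → i.Val) (hmodel : N.IsModel ξ μ)
    (hδ : 1 ≤ N.δ) (hround : ∀ m, 1 + N.δ + N.τ m ≤ N.τr)
    (hps : 0 < N.ps) (hpo : ∀ m, N.po m < 1)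
    (hβ₁ : 0 < N.β₁) (hβ₂ : 0 < N.β₂) (hε₀ : N.ε₀ < 1) (hη : 0 < N.η)
    (hΦ : MeasurableSet N.Φ) (hΦ_pos : 0 < volume N.Φ) (hΦ_fin : volume N.Φ < ⊤)
    -- the sensing coverage of any data at the sink, or at least the part of it that is needed to
    -- decide whether the target ratio is reached, lies in the network region
    (hincl : (∀ (m : Mode) (a : ℝ), 2 + N.τ m ≤ a → N.coverage a ⊆ N.Φ) ∨
      Metric.closedBall N.x N.targetRadius ⊆ N.Φ) :
    -- the coverage probability
    IsSteadyStateProb μ (fun t => {ω | N.η ≤ N.coverageRatio (N.aoi ξ t ω)})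
      (1 - N.px / N.τr * N.meanViolation N.vth) ∧
    -- it is the complement of the violation probability of the target age
    (∃ q, IsSteadyStateProb μ (fun t => {ω | N.vth < N.aoi ξ t ω}) q ∧
      1 - N.px / N.τr * N.meanViolation N.vth = 1 - q ∧
      -- which is the ratio of the mean violation time and the mean inter-update time
      ∀ k, 1 ≤ k →
        Integrable (N.U ξ k) μ ∧ Integrable (N.g ξ N.vth k) μ ∧
        (∫ ω, N.U ξ k ω ∂μ) = N.τr / N.px ∧
        (∫ ω, N.g ξ N.vth k ω ∂μ) = N.meanViolation N.vth ∧
        q = (∫ ω, N.g ξ N.vth k ω ∂μ) / ∫ ω, N.U ξ k ω ∂μ) := by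
  have hζ : ∀ m, N.ζ m N.δ ≠ 0 := fun m =>
    (N.ζ_pos (hmodel.po_nonneg m) (hpo m) (c := N.δ) (by lia)).ne'
  have hs := N.successProb_pos hmodel.po_nonneg hpo hδ hmodel.modeProb_nonneg
  have hpx : 0 < N.px := mul_pos hps hs
  have hlag := hmodel.isLagSequence hδ hround hps hpo
  have hτr := hlag.pos
  have hτr' : (0 : ℝ) < N.τr := by exact_mod_cast hτr
  have hDT : N.deliveryProb N.τr = N.px := N.deliveryProb_eq_px hround le_rfl
  set κ := ageThreshold N.vth with hκ
  have hmean := Network.meanViolation_eq hδ hround hs.ne' hζ hpo hpx.ne' N.vth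
  rw [← hκ] at hmean
  have hq : (∑ s ∈ Finset.range N.τr, survival N.deliveryProb N.τr κ s) / N.τr =
      N.px / N.τr * N.meanViolation N.vth := by
    rw [hmean, sum_survival hτr]
    field_simp
  have h₁ := hlag.tendsto_measureReal_staleSet κ
  have h₂ := hlag.ae_tendsto_staleSet κ
  rw [hq] at h₁ h₂
  -- The starting time must exceed two transients: κ for the description by stale sets, and 2 + τ of
  -- edge computing so that the initial data is not younger than the ages covered by the inclusion
  -- hypothesis.
  refine ⟨isSteadyStateProb_compl (max κ (2 + N.τ .ec)) (fun t => hlag.measurableSet_staleSet t κ)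
    (fun t ht => ?_) h₁ h₂, N.px / N.τr * N.meanViolation N.vth,
    isSteadyStateProb_of_tendsto κ
      (fun t ht => Network.setOf_lt_aoi_eq_staleSet hτr ht) h₁ h₂, rfl, fun k hk => ?_⟩
  · rw [← Network.setOf_lt_aoi_eq_staleSet hτr ((le_max_left _ _).trans ht)]
    ext ω
    obtain ⟨m, hm⟩ := Network.exists_mode_le_aoi (ξ := ξ) ((le_max_right _ _).trans ht) ω
    rw [Set.mem_ofPred_eq, Set.mem_compl_iff, Set.mem_ofPred_eq, not_lt]
    exact Network.le_coverageRatio_iff hβ₁ hβ₂ hε₀ hη hΦ_pos hΦ_fin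
      (hincl.imp_left fun hc => hc m _ hm)
  · obtain ⟨k, rfl⟩ := Nat.exists_eq_add_of_le' hk
    have hU : (fun ω => ((peakAge (N.lag ξ) N.τr k ω -
        max (N.lag ξ (deliveryRound (N.lag ξ) k ω) ω) 0 : ℕ) : ℝ)) =ᵐ[μ] N.U ξ (k + 1) := by
      filter_upwards [hlag.ae_infinite] with ω hω using (Network.U_eq hround hω k).symm
    have hg : (fun ω => ((peakAge (N.lag ξ) N.τr k ω -
        max (N.lag ξ (deliveryRound (N.lag ξ) k ω) ω) κ : ℕ) : ℝ)) =ᵐ[μ]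
        N.g ξ N.vth (k + 1) := by
      filter_upwards [hlag.ae_infinite] with ω hω using (Network.g_eq hround hω N.vth k).symm
    -- Age level 0 counts every slot of the cycle and thus gives its length; level κ gives the
    -- violation time.
    obtain ⟨hUi, hUe⟩ := hlag.integral_peakAge_sub k 0
    obtain ⟨hgi, hge⟩ := hlag.integral_peakAge_sub k κ
    rw [integral_congr_ae hU, hDT, Finset.range_zero, Finset.sum_empty, sub_zero] at hUe
    rw [integral_congr_ae hg, hDT, ← hmean] at hge
    refine ⟨hUi.congr hU, hgi.congr hg, hUe, hge, ?_⟩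
    rw [hUe, hge]
    field_simp
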